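/- Let $r\ge 1$ and let $\lambda=(a_1,\dots,a_r)$ be a sequence of integers with $a_1>a_2>\cdots>a_r=0$ (a dominant regular integral weight for $GL_r$). Put $\rho=(r-1,r-2,\dots,0)$, and for a sequence $\mu=(b_1,\dots,b_r)$ of nonnegative integers let $S(\mu)=\det\bigl(x_i^{b_j}\bigr)_{1\le i,j\le r}\in\mathbb{C}[x_1,\dots,x_r]$. Let $d(\lambda)=\gcd(a_1,\dots,a_r)$. If $\lambda$ is not an integer multiple of $\rho$ (equivalently, $\lambda\ne d(\lambda)\rho$), then the quotient $$C(\lambda)=\frac{S(\lambda)}{S(d(\lambda)\rho)}=\frac{\det\bigl(x_i^{a_j}\bigr)}{\det\bigl(x_i^{d(\lambda)(r-j)}\bigr)}$$ is a polynomial, and it is irreducible in the ring $\mathbb{C}[x_1,\dots,x_r]$. -/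

import Mathlib

noncomputable section

namespace SchurWeyl

/-- A weight `μ = (b_1, …, b_r)` of `GL_r` with nonnegative integer entries; the entry `b_j` is
`μ ⟨j - 1, _⟩`. -/
abbrev Weight (r : ℕ) : Type := Fin r → ℕ

/-- The Weyl weight `ρ = (r - 1, r - 2, …, 0)`. The subtraction never truncates, since an index
`j : Fin r` satisfies `j ≤ r - 1`. -/
def rho (r : ℕ) : Weight r := fun j => r - 1 - (j : ℕ)

/-- The Schur-Weyl function `S(μ) = det (x_i ^ b_j)` in `ℂ[x_1, …, x_r]`. -/
def S {r : ℕ} (μ : Weight r) : MvPolynomial (Fin r) ℂ :=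
  Matrix.det (Matrix.of fun i j : Fin r => MvPolynomial.X i ^ μ j)

/-- `d(μ)`, the greatest common divisor of the entries of `μ`. -/
def d {r : ℕ} (μ : Weight r) : ℕ := Finset.univ.gcd μ

/-- The quotient `C(μ) = S(μ) / S(d(μ) ρ)`, formed in the field of rational functions
`ℂ(x_1, …, x_r)`. That it is a polynomial is not built into the definition. -/
def C {r : ℕ} (μ : Weight r) : FractionRing (MvPolynomial (Fin r) ℂ) :=
  algebraMap (MvPolynomial (Fin r) ℂ) (FractionRing (MvPolynomial (Fin r) ℂ)) (S μ) /
    algebraMap (MvPolynomial (Fin r) ℂ) (FractionRing (MvPolynomial (Fin r) ℂ)) (S (d μ • rho r))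

end SchurWeyl

end

/-! Write the weight as d·a with the entries of a coprime and r = s + 1, and suppose S(d·a) =
P·Q·S(dρ). Let ξ be a generic point over ℂ and make the last row of the determinant variable: after
multiplication by ξ_s this is f = ∑ c_j X^(d a_j), and the c_j are algebraically independent
(`isTranscendenceBasis_detCoeff`), so f is the generic polynomial with these exponents. Call an
r-tuple of roots of f admissible if their d-th powers are distinct. At such a tuple S(d·a) vanishes,
since c lies in the kernel of the matrix, while S(dρ), a Vandermonde determinant in the d-th powers,
does not; hence P or Q vanishes there.

The automorphisms over ℂ fixing c act transitively on admissible tuples (`exists_map_family`), so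
one factor, say P, vanishes at all of them (`factor_vanishes`). As polynomials in the last variable,
P and S(dρ) then account for all roots of f, which are simple, so Q has degree 0 in that variable;
by symmetry Q is constant (`isUnit_of_vanishes`). The quotient itself is not a unit, by comparing
degrees (`eq_rho_of_isUnit`).

For transitivity, put g = ∑ c_j X^(a_j), so that f(X) = g(X^d). The group acts on the roots of g as
the full symmetric group (`rootPermSubgroup_eq_top`): it is doubly transitive, because two roots can
replace two coefficients in the transcendence basis, and it contains a transposition, obtained by
degenerating g to a polynomial with one double root. Moreover the d-th roots of the different roots
of g can be rotated independently (`single_mem_rotationSubgroup`): degenerating f to a binomial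
gives a (d a_i)-cycle, a power of which rotates the d-th roots of exactly a_i roots of g, and
coprimality reduces a_i to one. Both cycles are inertia elements w ↦ ωw of a pencil over power
series in w (`exists_cycle`). -/

namespace SparsePolynomial

open Polynomial

/-! ### Hensel's lemma and the roots of a ramified pencil over power series. -/

section PowerSeriesRoots

variable {k : Type*} [Field k]

/-- One step of Newton approximation for a simple root modulo the variable. -/
theorem exists_next_approximation (p : (PowerSeries k)[X]) (y : PowerSeries k) (n : ℕ) (hn : 1 ≤ n)
    (hy : PowerSeries.X ^ n ∣ p.eval y)
    (hd : PowerSeries.constantCoeff (p.derivative.eval y) ≠ 0) :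
    ∃ t : k, PowerSeries.X ^ (n + 1) ∣ p.eval (y + PowerSeries.X ^ n * PowerSeries.C t) := by
  obtain ⟨e, he⟩ := hy
  refine ⟨-(PowerSeries.constantCoeff e) / PowerSeries.constantCoeff (p.derivative.eval y), ?_⟩
  set t := -(PowerSeries.constantCoeff e) / PowerSeries.constantCoeff (p.derivative.eval y) with ht
  obtain ⟨b, hb⟩ :=
    p.exists_mul_sq_add_linear_part_eq_eval_add y (PowerSeries.X ^ n * PowerSeries.C t)
  have h1 : (PowerSeries.X : PowerSeries k) ∣ p.derivative.eval y * PowerSeries.C t + e := by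
    rw [PowerSeries.X_dvd_iff]
    simp only [map_add, map_mul, PowerSeries.constantCoeff_C, ht]
    field_simp
    ring
  obtain ⟨u, hu⟩ := h1
  -- As n ≥ 1, the quadratic error of order 2n is still divisible by the (n + 1)-st power of the
  -- variable.
  obtain ⟨l, rfl⟩ := Nat.exists_eq_add_of_le hn
  refine ⟨u + b * PowerSeries.C t ^ 2 * PowerSeries.X ^ l, ?_⟩
  rw [← hb, he]
  linear_combination (PowerSeries.X ^ (1 + l)) * hu

theorem constantCoeff_eval (p : (PowerSeries k)[X]) (y : PowerSeries k) :
    PowerSeries.constantCoeff (p.eval y) =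
      (p.map PowerSeries.constantCoeff).eval (PowerSeries.constantCoeff y) := by
  rw [Polynomial.eval_map, Polynomial.eval₂_hom]

/-- Hensel's lemma for power series, without any monicity assumption. -/
theorem exists_powerSeries_root (p : (PowerSeries k)[X]) (z : k)
    (h0 : (p.map PowerSeries.constantCoeff).eval z = 0)
    (h1 : (p.derivative.map PowerSeries.constantCoeff).eval z ≠ 0) :
    ∃ y : PowerSeries k, p.eval y = 0 ∧ PowerSeries.constantCoeff y = z := by
  let A := {q : PowerSeries k × ℕ // 1 ≤ q.2 ∧ PowerSeries.constantCoeff q.1 = z ∧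
    PowerSeries.X ^ q.2 ∣ p.eval q.1}
  have hstep : ∀ q : A, ∃ q' : A, q'.1.2 = q.1.2 + 1 ∧
      PowerSeries.X ^ q.1.2 ∣ q'.1.1 - q.1.1 := by
    rintro ⟨⟨y, n⟩, hn, hz, hd⟩
    simp only at hn hz hd
    obtain ⟨t, ht⟩ := exists_next_approximation p y n hn hd (by
      rw [constantCoeff_eval, hz]; exact h1)
    refine ⟨⟨⟨y + PowerSeries.X ^ n * PowerSeries.C t, n + 1⟩, by simp, ?_, ht⟩, rfl, ?_⟩
    · simp [hz, show n ≠ 0 by lia]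
    · simp
  choose nxt hn1 hn2 using hstep
  let q0 : A := ⟨⟨PowerSeries.C z, 1⟩, le_rfl, by simp, by
    rw [pow_one, PowerSeries.X_dvd_iff, constantCoeff_eval]; simpa using h0⟩
  let q : ℕ → A := fun n => nxt^[n] q0
  have hq : ∀ n, q (n + 1) = nxt (q n) := fun n => Function.iterate_succ_apply' _ _ _
  have hq2 : ∀ n, (q n).1.2 = n + 1 := by
    intro n
    induction n with
    | zero => rfl
    | succ n ih => rw [hq, hn1, ih]
  have hdiff : ∀ n l, PowerSeries.X ^ (n + 1) ∣ (q (n + l)).1.1 - (q n).1.1 := by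
    intro n l
    induction l with
    | zero => simp
    | succ l ih =>
      have h := hn2 (q (n + l))
      rw [← hq, hq2] at h
      have h' := (pow_dvd_pow PowerSeries.X (show n + 1 ≤ n + l + 1 by lia)).trans h
      have := dvd_add h' ih
      simpa [add_assoc] using this
  -- The approximations stabilize: `q n` is already correct modulo the (n + 1)-st power, so its n-th
  -- coefficient is final.
  let y : PowerSeries k := PowerSeries.mk fun n => PowerSeries.coeff n (q n).1.1
  have hy : ∀ n, PowerSeries.X ^ (n + 1) ∣ y - (q n).1.1 := by
    intro n
    rw [PowerSeries.X_pow_dvd_iff]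
    intro i hi
    obtain ⟨l, rfl⟩ := Nat.exists_eq_add_of_le (Nat.lt_succ_iff.mp hi)
    have := PowerSeries.X_pow_dvd_iff.mp (hdiff i l) i (by lia)
    simp only [map_sub] at this ⊢
    simp only [y, PowerSeries.coeff_mk]
    linear_combination -this
  refine ⟨y, ?_, ?_⟩
  · ext n
    have h := (hy n).trans (Polynomial.sub_dvd_eval_sub y (q n).1.1 p)
    have h2 := (q n).2.2.2
    rw [hq2] at h2
    have := dvd_add h h2
    rw [sub_add_cancel] at this
    simpa using PowerSeries.X_pow_dvd_iff.mp this n (by lia)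
  · have h := (dvd_pow_self _ (show 0 + 1 ≠ 0 by simp)).trans (hy 0)
    rw [PowerSeries.X_dvd_iff, map_sub, (q 0).2.2.1, sub_eq_zero] at h
    exact h

theorem powerSeries_root_unique {p : (PowerSeries k)[X]} {y y' : PowerSeries k}
    (h : p.eval y = 0) (h' : p.eval y' = 0)
    (hc : PowerSeries.constantCoeff y = PowerSeries.constantCoeff y')
    (hd : (p.derivative.map PowerSeries.constantCoeff).eval (PowerSeries.constantCoeff y) ≠ 0) :
    y = y' := by
  refine IsLocalRing.eq_of_eval_eq_zero_of_not_isUnit_sub h h' ?_ ?_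
  · rw [PowerSeries.isUnit_iff_constantCoeff]
    simp [hc]
  · rw [PowerSeries.isUnit_iff_constantCoeff, constantCoeff_eval]
    exact hd.isUnit

/-- The pencil `(1 - w ^ m) f₀ + w ^ m f₁` of polynomials over the power series ring in `w`. -/
noncomputable def pencil (m : ℕ) (f₀ f₁ : k[X]) : (PowerSeries k)[X] :=
  C (1 - PowerSeries.X ^ m) * f₀.map PowerSeries.C + C (PowerSeries.X ^ m) * f₁.map PowerSeries.C

theorem rescale_C_apply (ω b : k) :
    PowerSeries.rescale ω (PowerSeries.C b) = PowerSeries.C b := by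
  ext n
  rw [PowerSeries.coeff_rescale, PowerSeries.coeff_C]
  split_ifs with h <;> simp [h]

/-- Only w ^ m occurs in the coefficients, so w ↦ ω w preserves the pencil and hence permutes its
roots. -/
theorem map_rescale_pencil {m : ℕ} {ω : k} (hω : ω ^ m = 1) (f₀ f₁ : k[X]) :
    (pencil m f₀ f₁).map (PowerSeries.rescale ω) = pencil m f₀ f₁ := by
  have hX : PowerSeries.rescale ω (PowerSeries.X ^ m) = PowerSeries.X ^ m := by
    rw [map_pow, PowerSeries.rescale_X, mul_pow, ← map_pow, hω, map_one, one_mul]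
  have hC : (PowerSeries.rescale ω).comp PowerSeries.C = (PowerSeries.C : k →+* _) := by
    ext1 b
    exact rescale_C_apply ω b
  have h1X : PowerSeries.rescale ω (1 - PowerSeries.X ^ m) = 1 - PowerSeries.X ^ m := by
    rw [map_sub, map_one, hX]
  simp only [pencil, Polynomial.map_add, Polynomial.map_mul, Polynomial.map_C,
    hX, h1X, Polynomial.map_map, hC]

theorem eval_rescale_pencil {m : ℕ} {ω : k} (hω : ω ^ m = 1) (f₀ f₁ : k[X]) {y : PowerSeries k}
    (hy : (pencil m f₀ f₁).eval y = 0) :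
    (pencil m f₀ f₁).eval (PowerSeries.rescale ω y) = 0 := by
  conv_lhs => rw [← map_rescale_pencil hω f₀ f₁]
  rw [Polynomial.eval_map, Polynomial.eval₂_hom, hy, map_zero]

theorem map_constantCoeff_pencil {m : ℕ} (hm : m ≠ 0) (f₀ f₁ : k[X]) :
    (pencil m f₀ f₁).map PowerSeries.constantCoeff = f₀ := by
  have h : (PowerSeries.constantCoeff).comp (PowerSeries.C : k →+* _) = RingHom.id k := by
    ext b; simp
  simp [pencil, Polynomial.map_map, h, hm]

/-- A root of the pencil near an `m`-fold root `τ` of `f₀`. -/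
theorem exists_ramified_root {m : ℕ} (hm : m ≠ 0) [IsAlgClosed k] [CharZero k] (τ : k)
    (h f₁ : k[X]) (hτ : h.eval τ ≠ 0) (h1 : f₁.eval τ ≠ 0) :
    ∃ y : PowerSeries k, (pencil m ((X - C τ) ^ m * h) f₁).eval y = 0 ∧
      PowerSeries.constantCoeff y = τ ∧ PowerSeries.coeff 1 y ≠ 0 := by
  let l : (PowerSeries k)[X] := C (PowerSeries.C τ) + C PowerSeries.X * X
  -- The pencil at τ + w v, divided by w ^ m. At w = 0 it becomes h(τ) v ^ m + f₁(τ), whose roots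
  -- are nonzero and simple, so Hensel's lemma applies to v.
  let Φ : (PowerSeries k)[X] := C (1 - PowerSeries.X ^ m) * X ^ m * (h.map PowerSeries.C).comp l +
    (f₁.map PowerSeries.C).comp l
  have hcomp : (PowerSeries.constantCoeff).comp (PowerSeries.C : k →+* _) = RingHom.id k := by
    ext b; simp
  have hl : l.map PowerSeries.constantCoeff = C τ := by simp [l]
  have hΦ : Φ.map PowerSeries.constantCoeff = C (h.eval τ) * X ^ m + C (f₁.eval τ) := by
    simp only [Φ, Polynomial.map_add, Polynomial.map_mul, Polynomial.map_comp, hl,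
      Polynomial.map_map, hcomp, Polynomial.map_id, Polynomial.comp_C, Polynomial.map_pow,
      Polynomial.map_X, Polynomial.map_C]
    simp only [map_sub, map_one, map_pow, PowerSeries.constantCoeff_X, zero_pow hm, sub_zero]
    ring
  obtain ⟨z, hz⟩ := IsAlgClosed.exists_pow_nat_eq (-(f₁.eval τ) / h.eval τ) (Nat.pos_of_ne_zero hm)
  have hz0 : z ≠ 0 := by
    rintro rfl
    rw [zero_pow hm] at hz
    exact (div_ne_zero (neg_ne_zero.mpr h1) hτ) hz.symm
  obtain ⟨v, hv, hvz⟩ := exists_powerSeries_root Φ z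
    (by rw [hΦ]; simp only [eval_add, eval_mul, eval_C, eval_pow, eval_X, hz]; field_simp; ring)
    (by
      rw [← Polynomial.derivative_map, hΦ]
      simp [hτ, hm, hz0, derivative_X_pow])
  have hlv : l.eval v = PowerSeries.C τ + PowerSeries.X * v := by simp [l]
  refine ⟨PowerSeries.C τ + PowerSeries.X * v, ?_, by simp, ?_⟩
  · simp only [Φ, eval_add, eval_mul, eval_comp, hlv, eval_pow, eval_X, eval_C] at hv
    simp only [pencil, Polynomial.map_mul, Polynomial.map_pow, Polynomial.map_sub, map_X, map_C,
      eval_add, eval_mul, eval_pow, eval_sub, eval_X, eval_C]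
    linear_combination (PowerSeries.X ^ m) * hv
  · have : PowerSeries.coeff 1 (PowerSeries.X * v) = z := by
      rw [show (1 : ℕ) = 0 + 1 from rfl, PowerSeries.coeff_succ_X_mul]
      simpa using hvz
    rw [map_add, this, PowerSeries.coeff_C]
    simpa using hz0

/-- The roots of the pencil `(1 - w ^ m) f₀ + w ^ m f₁`, where `f₀` has an `m`-fold root and
otherwise simple roots: the automorphism `w ↦ ω w` fixes those near simple roots of `f₀` and
permutes the others cyclically. -/
theorem exists_pencil_roots {m : ℕ} (hm : m ≠ 0) [IsAlgClosed k] [CharZero k] (τ : k)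
    (h f₁ : k[X]) (hsep : h.Separable) (hτ : h.eval τ ≠ 0) (h1 : f₁.eval τ ≠ 0)
    {ω : k} (hω : IsPrimitiveRoot ω m) :
    ∃ (y : PowerSeries k) (T : Finset (PowerSeries k)), T.card = h.natDegree ∧
      (∀ t ∈ T, (pencil m ((X - C τ) ^ m * h) f₁).eval t = 0 ∧ PowerSeries.rescale ω t = t) ∧
      (∀ j, (pencil m ((X - C τ) ^ m * h) f₁).eval (PowerSeries.rescale (ω ^ j) y) = 0) ∧
      (∀ i < m, ∀ j < m, PowerSeries.rescale (ω ^ i) y = PowerSeries.rescale (ω ^ j) y → i = j) ∧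
      ∀ j, PowerSeries.rescale (ω ^ j) y ∉ T := by
  classical
  obtain ⟨y, hy, hyτ, hy1⟩ := exists_ramified_root hm τ h f₁ hτ h1
  set p := pencil m ((X - C τ) ^ m * h) f₁ with hp
  have hpc : p.map PowerSeries.constantCoeff = (X - C τ) ^ m * h := map_constantCoeff_pencil hm _ _
  have hρ : ∀ ρ ∈ h.roots, ρ ≠ τ ∧
      (p.derivative.map PowerSeries.constantCoeff).eval ρ ≠ 0 := by
    intro ρ hρ
    have hr : h.eval ρ = 0 := (Polynomial.mem_roots'.mp hρ).2
    have hne : ρ ≠ τ := by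
      rintro rfl
      exact hτ hr
    refine ⟨hne, ?_⟩
    rw [← Polynomial.derivative_map, hpc, derivative_mul]
    simp only [eval_add, eval_mul, hr, mul_zero, zero_add, eval_pow, eval_sub, eval_X, eval_C]
    exact mul_ne_zero (pow_ne_zero _ (sub_ne_zero.mpr hne))
      (by simpa using hsep.aeval_derivative_ne_zero (x := ρ) (by simpa using hr))
  have hex : ∀ ρ : h.roots.toFinset, ∃ t : PowerSeries k, p.eval t = 0 ∧
      PowerSeries.constantCoeff t = ρ := by
    intro ρ
    have hmem := Multiset.mem_toFinset.mp ρ.2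
    refine exists_powerSeries_root p ρ ?_ (hρ _ hmem).2
    rw [hpc, eval_mul, show h.eval (ρ : k) = 0 from (Polynomial.mem_roots'.mp hmem).2, mul_zero]
  choose t ht0 htρ using hex
  have hcr : ∀ (b : k) (u : PowerSeries k), PowerSeries.constantCoeff (PowerSeries.rescale b u) =
      PowerSeries.constantCoeff u := by
    intro b u
    rw [← PowerSeries.coeff_zero_eq_constantCoeff_apply, PowerSeries.coeff_rescale]
    simp
  refine ⟨y, Finset.univ.image t, ?_, ?_, ?_, ?_, ?_⟩
  · rw [Finset.card_image_of_injective, Finset.card_univ, Fintype.card_coe]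
    · rw [Multiset.toFinset_card_of_nodup (Polynomial.nodup_roots hsep),
        ← (IsAlgClosed.splits h).natDegree_eq_card_roots]
    · intro ρ ρ' he
      rw [← Subtype.coe_inj, ← htρ, ← htρ, he]
  · intro u hu
    obtain ⟨ρ, -, rfl⟩ := Finset.mem_image.mp hu
    -- Rescaling keeps the constant term, and only one root lies over a simple root of the
    -- reduction.
    refine ⟨ht0 ρ, powerSeries_root_unique (eval_rescale_pencil hω.pow_eq_one _ _ (ht0 ρ))
      (ht0 ρ) (hcr _ _) ?_⟩
    rw [hcr, htρ]
    exact (hρ _ (Multiset.mem_toFinset.mp ρ.2)).2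
  · intro j
    exact eval_rescale_pencil (by rw [← pow_mul, mul_comm, pow_mul, hω.pow_eq_one, one_pow]) _ _ hy
  · intro i hi j hj he
    -- The nonzero linear coefficient of y is multiplied by ω ^ i, which separates the m conjugates.
    have := congrArg (PowerSeries.coeff 1) he
    simp only [PowerSeries.coeff_rescale, pow_one] at this
    exact hω.pow_inj hi hj (mul_right_cancel₀ hy1 this)
  · intro j hj
    obtain ⟨ρ, -, he⟩ := Finset.mem_image.mp hj
    have := congrArg PowerSeries.constantCoeff he
    rw [hcr, hyτ, htρ] at this
    exact (hρ _ (Multiset.mem_toFinset.mp ρ.2)).1 this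

end PowerSeriesRoots

end SparsePolynomial

namespace SparsePolynomial

open Polynomial

/-- The polynomial `∑ j, c j * X ^ a j`. -/
noncomputable def sparse {R : Type*} [CommSemiring R] {r : ℕ} (a : Fin r → ℕ) (c : Fin r → R) :
    R[X] := ∑ j, C (c j) * X ^ a j

theorem map_sparse {R S : Type*} [CommSemiring R] [CommSemiring S] {r : ℕ} (a : Fin r → ℕ)
    (c : Fin r → R) (φ : R →+* S) : (sparse a c).map φ = sparse a fun j => φ (c j) := by
  simp [sparse, Polynomial.map_sum]

theorem eval_sparse {R : Type*} [CommSemiring R] {r : ℕ} (a : Fin r → ℕ)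
    (c : Fin r → R) (x : R) : (sparse a c).eval x = ∑ j, c j * x ^ a j := by
  simp [sparse, eval_finsetSum]

/-! ### Automorphisms fixing the coefficients, and their transfer from a specialization. -/

section Specialization

variable {L : Type*} [Field L] [Algebra ℂ L] {r : ℕ}

/-- The automorphisms of `L` over `ℂ` fixing the coefficients `c j`. -/
def coeffStabilizer (c : Fin r → L) : Subgroup (L ≃ₐ[ℂ] L) where
  carrier := {σ | ∀ j, σ (c j) = c j}
  mul_mem' := fun {σ τ} hσ hτ j => by rw [AlgEquiv.mul_apply, hτ j, hσ j]
  one_mem' := fun _ => rfl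
  inv_mem' := fun {σ} hσ j => by
    rw [AlgEquiv.aut_inv, AlgEquiv.symm_apply_eq, hσ j]

theorem mem_coeffStabilizer {c : Fin r → L} {σ : L ≃ₐ[ℂ] L} :
    σ ∈ coeffStabilizer c ↔ ∀ j, σ (c j) = c j := Iff.rfl

theorem isRoot_apply {c : Fin r → L} {σ : L ≃ₐ[ℂ] L} (hσ : σ ∈ coeffStabilizer c)
    {a : Fin r → ℕ} {x : L} (hx : (sparse a c).IsRoot x) : (sparse a c).IsRoot (σ x) := by
  rw [IsRoot.def, eval_sparse] at hx ⊢
  have := congrArg σ hx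
  simpa [map_sum, mem_coeffStabilizer.mp hσ] using this

/-- `L` is an algebraic closure of `K`, so it embeds in `E` over `K`; its image is normal over `K`,
hence stable under σ'. -/
theorem exists_pullback_of_algHom [IsAlgClosed L] {K : Type*} [Field K] [Algebra ℂ K] [Algebra K L]
    [IsScalarTower ℂ K L] [Algebra.IsAlgebraic K L] {E : Type*} [Field E] [Algebra ℂ E]
    [IsAlgClosed E] (φ : K →ₐ[ℂ] E) (σ' : E ≃ₐ[ℂ] E) (hσ' : ∀ z, σ' (φ z) = φ z) :
    ∃ (ι : L →ₐ[ℂ] E) (σ : L ≃ₐ[ℂ] L), (∀ z, ι (algebraMap K L z) = φ z) ∧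
      (∀ z, σ (algebraMap K L z) = algebraMap K L z) ∧ ∀ x, ι (σ x) = σ' (ι x) := by
  let _ : Algebra K E := φ.toRingHom.toAlgebra
  have : IsScalarTower ℂ K E := IsScalarTower.of_algebraMap_eq fun z => (φ.commutes z).symm
  let ι₀ : L →ₐ[K] E := IsAlgClosed.lift
  let _ : Algebra L E := ι₀.toRingHom.toAlgebra
  have : IsScalarTower K L E := IsScalarTower.of_algebraMap_eq fun z => (ι₀.commutes z).symm
  have : IsAlgClosure K L := ⟨inferInstance, inferInstance⟩
  have : Normal K L := IsAlgClosure.normal K L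
  let σK : E ≃ₐ[K] E := AlgEquiv.ofRingEquiv (f := σ'.toRingEquiv) fun z => hσ' z
  exact ⟨ι₀.restrictScalars ℂ, (σK.restrictNormal L).restrictScalars ℂ, ι₀.commutes,
    (σK.restrictNormal L).commutes, σK.restrictNormal_commutes L⟩

/-- An automorphism of an algebraically closed field `E` fixing a specialization `β` of the
generic coefficients `c` induces an automorphism of `L` fixing `c`. -/
theorem exists_pullback [IsAlgClosed L] {c : Fin r → L} (hc : IsTranscendenceBasis ℂ c)
    {E : Type*} [Field E] [Algebra ℂ E] [IsAlgClosed E] {β : Fin r → E}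
    (hβ : AlgebraicIndependent ℂ β) (σ' : E ≃ₐ[ℂ] E) (hσ' : ∀ j, σ' (β j) = β j) :
    ∃ (ι : L →ₐ[ℂ] E) (σ : L ≃ₐ[ℂ] L), σ ∈ coeffStabilizer c ∧ (∀ j, ι (c j) = β j) ∧
      ∀ x, ι (σ x) = σ' (ι x) := by
  let K := IntermediateField.adjoin ℂ (Set.range c)
  have hcK : ∀ j, c j ∈ K := fun j => IntermediateField.subset_adjoin _ _ ⟨j, rfl⟩
  let φ : K →ₐ[ℂ] E := (IntermediateField.adjoin ℂ (Set.range β)).val.comp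
    ((hβ.aevalEquivField.toAlgHom).comp hc.1.aevalEquivField.symm.toAlgHom)
  have hφ : ∀ j, φ ⟨c j, hcK j⟩ = β j := by
    intro j
    have h1 : hc.1.aevalEquivField.symm ⟨c j, hcK j⟩ = algebraMap (MvPolynomial (Fin r) ℂ) _ (MvPolynomial.X j) := by
      rw [AlgEquiv.symm_apply_eq]
      apply Subtype.ext
      rw [hc.1.aevalEquivField_algebraMap_apply_coe]
      simp
    change ((hβ.aevalEquivField (hc.1.aevalEquivField.symm ⟨c j, hcK j⟩) :
      IntermediateField.adjoin ℂ (Set.range β)) : E) = β j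
    rw [h1, hβ.aevalEquivField_algebraMap_apply_coe]
    simp
  have : Algebra.IsAlgebraic K L := hc.isAlgebraic_field
  have hfix : ((σ' : E →ₐ[ℂ] E).comp φ) = φ := by
    refine IntermediateField.algHom_ext_of_eq_adjoin ℂ (s := Set.range c) (S := K) rfl ?_
    rintro _ ⟨j, rfl⟩
    change σ' (φ ⟨c j, _⟩) = φ ⟨c j, _⟩
    rw [hφ, hσ']
  obtain ⟨ι, σ, h1, h2, h3⟩ :=
    exists_pullback_of_algHom (L := L) φ σ' fun z => DFunLike.congr_fun hfix z
  exact ⟨ι, σ, fun j => h2 ⟨c j, hcK j⟩, fun j => (h1 ⟨c j, hcK j⟩).trans (hφ j), h3⟩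

end Specialization

/-! ### Inertia: cycles obtained by degenerating the generic polynomial. -/

section Inertia

open PowerSeries in
/-- The automorphism of the algebraic closure of the field of fractions of `k⟦w⟧` extending
`w ↦ ω w`. -/
theorem exists_rescale_extension {k : Type*} [Field k] [Algebra ℂ k] {ω : k} (hω : ω ≠ 0) :
    ∃ σ : AlgebraicClosure (FractionRing k⟦X⟧) ≃ₐ[ℂ] AlgebraicClosure (FractionRing k⟦X⟧),
      ∀ u : k⟦X⟧, σ (algebraMap k⟦X⟧ _ u) = algebraMap k⟦X⟧ _ (rescale ω u) := by
  let e : k⟦X⟧ ≃+* k⟦X⟧ := RingEquiv.ofRingHom (rescale ω) (rescale ω⁻¹)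
    (by ext1 u; simp [rescale_rescale, hω]) (by ext1 u; simp [rescale_rescale, hω])
  let eQ : FractionRing k⟦X⟧ ≃+* FractionRing k⟦X⟧ := IsFractionRing.ringEquivOfRingEquiv e
  let E := AlgebraicClosure (FractionRing k⟦X⟧)
  let eE : E ≃+* E := IsAlgClosure.equivOfEquiv E E eQ
  have h : ∀ u : k⟦X⟧, eE (algebraMap k⟦X⟧ E u) = algebraMap k⟦X⟧ E (rescale ω u) := by
    intro u
    rw [IsScalarTower.algebraMap_apply k⟦X⟧ (FractionRing k⟦X⟧) E,
      IsAlgClosure.equivOfEquiv_algebraMap, IsFractionRing.ringEquivOfRingEquiv_algebraMap,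
      ← IsScalarTower.algebraMap_apply]
    rfl
  refine ⟨AlgEquiv.ofRingEquiv (f := eE) fun z => ?_, h⟩
  rw [IsScalarTower.algebraMap_apply ℂ k⟦X⟧ E, h, PowerSeries.algebraMap_apply, rescale_C_apply]

variable {L : Type*} [Field L] [Algebra ℂ L] [IsAlgClosed L] {r : ℕ}

/-- Specializing the generic polynomial `f = sparse a c` to a polynomial `(X - τ) ^ m * h` with
one `m`-fold root and otherwise simple roots yields an automorphism over the field of coefficients
which acts on the roots of `f` as an `m`-cycle. -/
theorem exists_cycle {c : Fin r → L} (hc : IsTranscendenceBasis ℂ c) {a : Fin r → ℕ}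
    {b : Fin r → ℂ} {m : ℕ} (hm : m ≠ 0) {τ : ℂ} {h : ℂ[X]}
    (hb : sparse a b = (X - C τ) ^ m * h) (hsep : h.Separable) (hτ : h.eval τ ≠ 0)
    (hfτ : (sparse a c).eval (algebraMap ℂ L τ) ≠ 0)
    (hdeg : (sparse a c).natDegree ≤ (sparse a b).natDegree) :
    (sparse a c).roots.Nodup ∧
    ∃ σ ∈ coeffStabilizer c, ∃ x₀ : L, (∀ j : ℕ, (sparse a c).IsRoot ((σ ^ j) x₀)) ∧
      (∀ i < m, ∀ j < m, (σ ^ i) x₀ = (σ ^ j) x₀ → i = j) ∧ (σ ^ m) x₀ = x₀ ∧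
      ∀ x, (sparse a c).IsRoot x → (∃ j < m, x = (σ ^ j) x₀) ∨ σ x = x := by
  classical
  have : CharZero L := charZero_of_injective_algebraMap (algebraMap ℂ L).injective
  set f := sparse a c with hf
  have hω := (Complex.isPrimitiveRoot_exp m hm).map_of_injective (algebraMap ℂ L).injective
  set ω := algebraMap ℂ L (Complex.exp (2 * Real.pi * Complex.I / m)) with hωdef
  let E := AlgebraicClosure (FractionRing (PowerSeries L))
  let κ : PowerSeries L →ₐ[ℂ] E := IsScalarTower.toAlgHom ℂ (PowerSeries L) E
  have hκ : Function.Injective κ := by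
    change Function.Injective (algebraMap (PowerSeries L) E)
    rw [IsScalarTower.algebraMap_eq (PowerSeries L) (FractionRing (PowerSeries L)) E]
    exact (algebraMap (FractionRing (PowerSeries L)) E).injective.comp
      (IsFractionRing.injective (PowerSeries L) (FractionRing (PowerSeries L)))
  set h' := h.map (algebraMap ℂ L) with hh'
  set τ' := algebraMap ℂ L τ with hτ'
  have hb' : (sparse a b).map (algebraMap ℂ L) = (X - C τ') ^ m * h' := by
    rw [hb]
    simp [hh', hτ']
  obtain ⟨y, T, hTc, hT, hy, hyinj, hyT⟩ := exists_pencil_roots hm τ' h' f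
    ((Polynomial.separable_map _).mpr hsep) (by
      rw [hh', hτ', Polynomial.eval_map_algebraMap, Polynomial.aeval_algebraMap_apply_eq_algebraMap_eval]
      simpa using hτ) hfτ hω
  set p := pencil m ((X - C τ') ^ m * h') f with hp
  -- the coefficients of the pencil
  let β₁ : Fin r → L[X] := fun j =>
    (1 - X ^ m) * C (algebraMap ℂ L (b j)) + X ^ m * C (c j)
  let β₀ : Fin r → PowerSeries L := fun j => (β₁ j : PowerSeries L)
  have hpβ : p = sparse a β₀ := by
    rw [hp, ← hb', pencil, map_sparse, map_sparse, hf, map_sparse]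
    simp only [sparse, Finset.mul_sum, ← Finset.sum_add_distrib, β₀, β₁]
    refine Finset.sum_congr rfl fun j _ => ?_
    rw [← mul_assoc, ← mul_assoc, ← add_mul, ← C_mul, ← C_mul, ← C_add]
    simp only [Polynomial.coe_add, Polynomial.coe_mul, Polynomial.coe_sub,
      Polynomial.coe_one, Polynomial.coe_pow, Polynomial.coe_X, Polynomial.coe_C]
  have hβ₁ : AlgebraicIndependent ℂ β₁ := by
    -- At w = 1 the coefficients of the pencil become `c`, so a relation between them would give one
    -- between the c j.
    refine AlgebraicIndependent.of_comp (f := (Polynomial.aeval (1 : L)).restrictScalars ℂ) ?_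
    convert hc.1 using 1
    ext j
    simp [β₁]
  have hβ : AlgebraicIndependent ℂ (fun j => κ (β₀ j)) := by
    have h2 : AlgebraicIndependent ℂ β₀ := by
      refine hβ₁.map' (f := ((Polynomial.coeToPowerSeries.algHom L).restrictScalars ℂ)) ?_
      intro u v huv
      exact Polynomial.coe_injective _ (by simpa using huv)
    exact h2.map' (f := κ) hκ
  obtain ⟨σ', hσ'⟩ := exists_rescale_extension (k := L) (hω.ne_zero hm)
  have hσβ : ∀ j, σ' (κ (β₀ j)) = κ (β₀ j) := by
    intro j
    refine (hσ' _).trans ?_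
    change κ _ = κ _
    congr 1
    have hX : PowerSeries.rescale ω (PowerSeries.X ^ m) = PowerSeries.X ^ m := by
      rw [map_pow, PowerSeries.rescale_X, mul_pow, ← map_pow, hω.pow_eq_one, map_one, one_mul]
    simp only [β₀, β₁, Polynomial.coe_add, Polynomial.coe_mul, Polynomial.coe_sub,
      Polynomial.coe_one, Polynomial.coe_pow, Polynomial.coe_X, Polynomial.coe_C, map_add, map_mul,
      map_sub, map_one, hX, rescale_C_apply]
  -- ι is not the embedding of `L` as constants: it sends `c` to the coefficients of the pencil, and
  -- so identifies the roots of f with those of the pencil.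
  obtain ⟨ι, σ, hσ, hιc, hισ⟩ := exists_pullback hc hβ σ' hσβ
  have hfι : f.map (ι : L →+* E) = p.map (κ : PowerSeries L →+* E) := by
    rw [hf, hpβ, map_sparse, map_sparse]
    congr 1
    ext j
    exact hιc j
  have hpow : ∀ (j : ℕ) (u : PowerSeries L),
      (σ' ^ j) (κ u) = κ (PowerSeries.rescale (ω ^ j) u) := by
    intro j u
    induction j with
    | zero => simp
    | succ j ih =>
      rw [pow_succ', AlgEquiv.mul_apply, ih, pow_succ, ← PowerSeries.rescale_rescale]
      exact hσ' _
  have hιpow : ∀ (j : ℕ) (x : L), ι ((σ ^ j) x) = (σ' ^ j) (ι x) := by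
    intro j x
    induction j with
    | zero => simp
    | succ j ih => rw [pow_succ', AlgEquiv.mul_apply, hισ, ih, pow_succ', AlgEquiv.mul_apply]
  have hpc : p.map PowerSeries.constantCoeff = (X - C τ') ^ m * h' := map_constantCoeff_pencil hm _ _
  have hh0 : h' ≠ 0 := ((Polynomial.separable_map _).mpr hsep).ne_zero
  have hp0 : p ≠ 0 := by
    intro h0
    rw [h0, Polynomial.map_zero] at hpc
    exact mul_ne_zero (pow_ne_zero m (X_sub_C_ne_zero τ')) hh0 hpc.symm
  have hdeg' : (sparse a b).natDegree = m + h'.natDegree := by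
    rw [← Polynomial.natDegree_map (algebraMap ℂ L), hb',
      natDegree_mul (pow_ne_zero m (X_sub_C_ne_zero τ')) hh0, natDegree_pow, natDegree_X_sub_C,
      mul_one]
  have hpκ0 : p.map (κ : PowerSeries L →+* E) ≠ 0 := (Polynomial.map_ne_zero_iff hκ).mpr hp0
  have hf0 : f ≠ 0 := by
    intro h0
    rw [h0] at hfι
    exact hpκ0 (by rw [← hfι, Polynomial.map_zero])
  have hroots : (p.map (κ : PowerSeries L →+* E)).roots = f.roots.map ι := by
    rw [← hfι]
    exact (IsAlgClosed.splits f).roots_map ι.toRingHom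
  let O := (Finset.range m).image fun j => PowerSeries.rescale (ω ^ j) y
  have hOc : O.card = m := by
    rw [Finset.card_image_of_injOn, Finset.card_range]
    intro i hi j hj hij
    exact hyinj i (by simpa using hi) j (by simpa using hj) hij
  have hdisj : Disjoint O T := by
    rw [Finset.disjoint_left]
    intro u hu
    obtain ⟨j, -, rfl⟩ := Finset.mem_image.mp hu
    exact hyT j
  have hsub : (O ∪ T).image κ ⊆ f.roots.toFinset.image ι := by
    intro v hv
    obtain ⟨u, hu, rfl⟩ := Finset.mem_image.mp hv
    have hu0 : p.eval u = 0 := by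
      rcases Finset.mem_union.mp hu with hu | hu
      · obtain ⟨j, -, rfl⟩ := Finset.mem_image.mp hu
        exact hy j
      · exact (hT u hu).1
    have : κ u ∈ (p.map (κ : PowerSeries L →+* E)).roots := by
      rw [Polynomial.mem_roots hpκ0, IsRoot.def, Polynomial.eval_map]
      change Polynomial.eval₂ (κ : PowerSeries L →+* E) ((κ : PowerSeries L →+* E) u) p = 0
      rw [Polynomial.eval₂_hom, hu0, map_zero]
    rw [hroots] at this
    obtain ⟨x, hx, hxu⟩ := Multiset.mem_map.mp this
    exact Finset.mem_image.mpr ⟨x, Multiset.mem_toFinset.mpr hx, hxu⟩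
  have hcard1 : ((O ∪ T).image κ).card = m + h'.natDegree := by
    rw [Finset.card_image_of_injective _ hκ, Finset.card_union_of_disjoint hdisj, hOc, hTc]
  have hcard2 : f.roots.toFinset.card ≤ m + h'.natDegree :=
    (Multiset.toFinset_card_le _).trans ((Polynomial.card_roots' f).trans (hdeg'.le.trans' hdeg))
  have hcard3 : (f.roots.toFinset.image ι).card = f.roots.toFinset.card :=
    Finset.card_image_of_injective _ ι.toRingHom.injective
  -- The m conjugates of y and the deg h fixed roots already exhaust the degree, so there are no
  -- further roots and all are simple.
  have heq : (O ∪ T).image κ = f.roots.toFinset.image ι :=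
    Finset.eq_of_subset_of_card_le hsub (by rw [hcard1, hcard3]; exact hcard2)
  have hnodup : f.roots.Nodup := by
    rw [← Multiset.toFinset_card_eq_card_iff_nodup]
    refine le_antisymm (Multiset.toFinset_card_le _) ?_
    rw [← hcard3, ← heq, hcard1]
    exact (Polynomial.card_roots' f).trans (hdeg'.le.trans' hdeg)
  refine ⟨hnodup, σ, hσ, ?_⟩
  have hy0 : κ y ∈ f.roots.toFinset.image ι := by
    rw [← heq]
    refine Finset.mem_image_of_mem _ (Finset.mem_union_left _ (Finset.mem_image.mpr
      ⟨0, by simpa using Nat.pos_of_ne_zero hm, by simp⟩))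
  obtain ⟨x₀, hx₀, hx₀y⟩ := Finset.mem_image.mp hy0
  have hιx : ∀ j : ℕ, ι ((σ ^ j) x₀) = κ (PowerSeries.rescale (ω ^ j) y) := by
    intro j
    rw [hιpow, hx₀y, hpow]
  have hroot0 : f.IsRoot x₀ := (Polynomial.mem_roots hf0).mp (Multiset.mem_toFinset.mp hx₀)
  refine ⟨x₀, fun j => isRoot_apply (Subgroup.pow_mem _ hσ j) hroot0, ?_, ?_, ?_⟩
  · intro i hi j hj hij
    apply hyinj i hi j hj
    apply hκ
    rw [← hιx, ← hιx, hij]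
  · apply ι.toRingHom.injective
    change ι _ = ι _
    rw [hιx, hω.pow_eq_one, hx₀y]
    simp
  · intro x hx
    have : ι x ∈ (O ∪ T).image κ := by
      rw [heq]
      exact Finset.mem_image_of_mem _ (Multiset.mem_toFinset.mpr ((Polynomial.mem_roots hf0).mpr hx))
    obtain ⟨u, hu, hux⟩ := Finset.mem_image.mp this
    rcases Finset.mem_union.mp hu with hu | hu
    · obtain ⟨j, hj, rfl⟩ := Finset.mem_image.mp hu
      refine Or.inl ⟨j, by simpa using hj, ?_⟩
      apply ι.toRingHom.injective
      change ι _ = ι _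
      rw [hιx, hux]
    · refine Or.inr ?_
      apply ι.toRingHom.injective
      change ι _ = ι _
      rw [hισ, ← hux]
      refine (hσ' _).trans ?_
      rw [(hT u hu).2]
      rfl

end Inertia

end SparsePolynomial

namespace SparsePolynomial

open Polynomial

/-! ### Exchanging and matching transcendence bases. -/

section Transcendence

variable {L : Type*} [Field L] [Algebra ℂ L] {ι : Type*}

/-- `L` is algebraic over ℂ(t), and t has as many members as the transcendence degree, which leaves
no room for a relation. -/
theorem isTranscendenceBasis_of_isAlgebraic [Finite ι] {c t : ι → L} (hc : IsTranscendenceBasis ℂ c)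
    (h : ∀ j, IsAlgebraic (IntermediateField.adjoin ℂ (Set.range t)) (c j)) :
    IsTranscendenceBasis ℂ t := by
  let K := IntermediateField.adjoin ℂ (Set.range t)
  let A := algebraicClosure K L
  have hle : (IntermediateField.adjoin ℂ (Set.range c)) ≤ A.restrictScalars ℂ := by
    rw [IntermediateField.adjoin_le_iff]
    rintro _ ⟨j, rfl⟩
    exact mem_algebraicClosure_iff'.mpr (h j).isIntegral
  have hA : Algebra.IsAlgebraic A L := by
    refine ⟨fun x => ?_⟩
    have hx := hc.isAlgebraic_field.isAlgebraic x
    exact hx.tower_top_of_subalgebra_le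
      (A := (IntermediateField.adjoin ℂ (Set.range c)).toSubalgebra)
      (B := (A.restrictScalars ℂ).toSubalgebra) hle
  have hK : Algebra.IsAlgebraic K L := Algebra.IsAlgebraic.trans K A L
  have : Algebra.IsAlgebraic (Algebra.adjoin ℂ (Set.range t)) L :=
    IntermediateField.isAlgebraic_adjoin_iff_top.mp hK
  refine Algebra.IsAlgebraic.isTranscendenceBasis_of_lift_le_trdeg_of_finite ℂ t ?_
  rw [hc.lift_cardinalMk_eq_trdeg]

/-- `L` is an algebraic closure over both polynomial algebras ℂ[t] and ℂ[t'], so the isomorphism t ↦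
t' extends. -/
theorem exists_algEquiv_of_isTranscendenceBasis [IsAlgClosed L] {t t' : ι → L}
    (ht : IsTranscendenceBasis ℂ t) (ht' : IsTranscendenceBasis ℂ t') :
    ∃ σ : L ≃ₐ[ℂ] L, ∀ i, σ (t i) = t' i := by
  let e : Algebra.adjoin ℂ (Set.range t) ≃ₐ[ℂ] Algebra.adjoin ℂ (Set.range t') :=
    ht.1.aevalEquiv.symm.trans ht'.1.aevalEquiv
  have := IsAlgClosed.isAlgClosure_of_transcendence_basis t ht
  have := IsAlgClosed.isAlgClosure_of_transcendence_basis t' ht'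
  let eL : L ≃+* L := IsAlgClosure.equivOfEquiv L L e.toRingEquiv
  have heL : ∀ z : Algebra.adjoin ℂ (Set.range t), eL z = e z := fun z =>
    IsAlgClosure.equivOfEquiv_algebraMap L L e.toRingEquiv z
  refine ⟨AlgEquiv.ofRingEquiv (f := eL) fun z => ?_, fun i => ?_⟩
  · have := heL (algebraMap ℂ _ z)
    rwa [e.commutes] at this
  · have hi : t i ∈ Algebra.adjoin ℂ (Set.range t) := Algebra.subset_adjoin ⟨i, rfl⟩
    refine (heL ⟨t i, hi⟩).trans ?_
    have h1 : ht.1.aevalEquiv.symm ⟨t i, hi⟩ = MvPolynomial.X i := by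
      rw [AlgEquiv.symm_apply_eq]
      apply Subtype.ext
      simp
    change ((ht'.1.aevalEquiv (ht.1.aevalEquiv.symm ⟨t i, hi⟩) :
      Algebra.adjoin ℂ (Set.range t')) : L) = _
    rw [h1]
    simp

end Transcendence

/-! ### The generic sparse polynomial and double transitivity. -/

section Generic

variable {s : ℕ} {a : Fin (s + 1) → ℕ}

theorem coeff_sparse {R : Type*} [CommSemiring R] {r : ℕ} {a : Fin r → ℕ}
    (ha : Function.Injective a) (b : Fin r → R) (i : Fin r) :
    (sparse a b).coeff (a i) = b i := by
  simp [sparse, finsetSum_coeff, coeff_X_pow, ha.eq_iff]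

theorem exponent_pos (ha : StrictAnti a) (ha0 : a (Fin.last s) = 0) {j : Fin (s + 1)}
    (hj : j ≠ Fin.last s) : 0 < a j := by
  have := ha (Fin.lt_last_iff_ne_last.mpr hj)
  lia

theorem natDegree_sparse_le {R : Type*} [CommSemiring R] (ha : StrictAnti a)
    (b : Fin (s + 1) → R) : (sparse a b).natDegree ≤ a 0 :=
  natDegree_sum_le_of_forall_le _ _ fun j _ =>
    (natDegree_C_mul_X_pow_le _ _).trans (ha.antitone (Fin.zero_le j))

theorem natDegree_sparse {R : Type*} [CommSemiring R] (ha : StrictAnti a)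
    {b : Fin (s + 1) → R} (hb : b 0 ≠ 0) : (sparse a b).natDegree = a 0 :=
  natDegree_eq_of_le_of_coeff_ne_zero (natDegree_sparse_le ha b)
    (by rwa [coeff_sparse ha.injective])

variable {L : Type*} [Field L] [Algebra ℂ L] {c : Fin (s + 1) → L}

theorem eval_generic_ne_zero (hc : AlgebraicIndependent ℂ c) (ha0 : a (Fin.last s) = 0) (τ : ℂ) :
    (sparse a c).eval (algebraMap ℂ L τ) ≠ 0 := by
  intro h0
  let p : MvPolynomial (Fin (s + 1)) ℂ := ∑ j, MvPolynomial.X j * MvPolynomial.C (τ ^ a j)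
  have hp : MvPolynomial.aeval c p = 0 := by
    rw [← h0, eval_sparse]
    simp [p, map_sum]
  have hp0 : p = 0 := (algebraicIndependent_iff.mp hc) p hp
  -- Keeping only the constant term of the generic polynomial leaves the value 1, as the last
  -- exponent is 0.
  have := congrArg (MvPolynomial.eval (Pi.single (Fin.last s) (1 : ℂ))) hp0
  simp [p, map_sum, Pi.single_apply, ha0] at this

theorem root_ne_zero (hc : AlgebraicIndependent ℂ c) (ha0 : a (Fin.last s) = 0) {x : L}
    (hx : (sparse a c).IsRoot x) : x ≠ 0 := by
  rintro rfl
  apply eval_generic_ne_zero hc ha0 0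
  rw [map_zero]
  exact hx

/-- Otherwise the order of u / v would divide every a j, hence 1. -/
theorem pow_ne_pow_of_gcd (hd : Finset.univ.gcd a = 1) {L : Type*} [Field L] {u v : L}
    (hv : v ≠ 0) (huv : u ≠ v) : ∃ j, u ^ a j ≠ v ^ a j := by
  by_contra! h
  apply huv
  have h1 : ∀ j, orderOf (u / v) ∣ a j := fun j => by
    rw [orderOf_dvd_iff_pow_eq_one, div_pow, h j, div_self (pow_ne_zero _ hv)]
  have h2 : orderOf (u / v) ∣ 1 := hd ▸ Finset.dvd_gcd fun j _ => h1 j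
  rw [Nat.dvd_one, orderOf_eq_one_iff] at h2
  rwa [div_eq_one_iff_eq hv] at h2

/-- Two roots can replace two of the coefficients in the transcendence basis. -/
theorem isTranscendenceBasis_of_roots_aux (hc : IsTranscendenceBasis ℂ c)
    (ha0 : a (Fin.last s) = 0) {u v : L} (hu : (sparse a c).IsRoot u) (hv : (sparse a c).IsRoot v)
    {j : Fin (s + 1)} (huv : u ^ a j ≠ v ^ a j) :
    IsTranscendenceBasis ℂ (Function.update (Function.update c (Fin.last s) v) j u) := by
  have hj : j ≠ Fin.last s := by
    rintro rfl
    simp [ha0] at huv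
  set t := Function.update (Function.update c (Fin.last s) v) j u with ht
  set K := IntermediateField.adjoin ℂ (Set.range t) with hK
  have htK : ∀ i, t i ∈ K := fun i => IntermediateField.subset_adjoin _ _ ⟨i, rfl⟩
  have huK : u ∈ K := by simpa [ht] using htK j
  have hvK : v ∈ K := by simpa [ht, hj.symm] using htK (Fin.last s)
  have hiK : ∀ i, i ≠ j → i ≠ Fin.last s → c i ∈ K := fun i h1 h2 => by
    simpa [ht, h1, h2] using htK i
  rw [IsRoot.def, eval_sparse, ← Finset.add_sum_erase _ _ (Finset.mem_univ (Fin.last s)),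
    ← Finset.add_sum_erase _ _ (Finset.mem_erase.mpr ⟨hj, Finset.mem_univ j⟩), ha0, pow_zero,
    mul_one] at hu hv
  have hS : ∀ w ∈ K, ∑ i ∈ (Finset.univ.erase (Fin.last s)).erase j, c i * w ^ a i ∈ K := by
    intro w hw
    refine sum_mem fun i hi => ?_
    simp only [Finset.mem_erase, Finset.mem_univ, and_true] at hi
    exact mul_mem (hiK i hi.1 hi.2) (pow_mem hw _)
  -- The root equations of u and v are linear in `c j` and `c (Fin.last s)`, with determinant ± (u ^
  -- a j - v ^ a j).
  have hcj : c j ∈ K := by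
    have : c j = -(∑ i ∈ (Finset.univ.erase (Fin.last s)).erase j, c i * u ^ a i -
        ∑ i ∈ (Finset.univ.erase (Fin.last s)).erase j, c i * v ^ a i) / (u ^ a j - v ^ a j) := by
      rw [eq_div_iff (sub_ne_zero.mpr huv)]
      linear_combination hu - hv
    rw [this]
    exact div_mem (neg_mem (sub_mem (hS u huK) (hS v hvK)))
      (sub_mem (pow_mem huK _) (pow_mem hvK _))
  have hcl : c (Fin.last s) ∈ K := by
    have : c (Fin.last s) = -(c j * u ^ a j +
        ∑ i ∈ (Finset.univ.erase (Fin.last s)).erase j, c i * u ^ a i) := by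
      linear_combination hu
    rw [this]
    exact neg_mem (add_mem (mul_mem hcj (pow_mem huK _)) (hS u huK))
  refine isTranscendenceBasis_of_isAlgebraic hc fun i => ?_
  have hmem : c i ∈ K := by
    by_cases h1 : i = j
    · rwa [h1]
    by_cases h2 : i = Fin.last s
    · rwa [h2]
    exact hiK i h1 h2
  exact isAlgebraic_algebraMap (⟨c i, hmem⟩ : K)

/-- Coprimality first gives some exchange position j, which makes u and v algebraically independent;
then u ^ a 0 ≠ v ^ a 0, and the exchange works at 0. Having the same position for every pair allows
two such bases to be matched entry by entry. -/
theorem isTranscendenceBasis_of_roots (hc : IsTranscendenceBasis ℂ c) (ha : StrictAnti a)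
    (hs : 0 < s) (ha0 : a (Fin.last s) = 0) (hd : Finset.univ.gcd a = 1) {u v : L}
    (hu : (sparse a c).IsRoot u) (hv : (sparse a c).IsRoot v) (huv : u ≠ v) :
    u ^ a 0 ≠ v ^ a 0 ∧
      IsTranscendenceBasis ℂ (Function.update (Function.update c (Fin.last s) v) 0 u) := by
  have hN : 0 < a 0 := exponent_pos ha ha0 (by simp [Fin.ext_iff]; lia)
  obtain ⟨j, hj⟩ := pow_ne_pow_of_gcd hd (root_ne_zero hc.1 ha0 hv) huv
  have hjl : Fin.last s ≠ j := by
    rintro rfl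
    simp [ha0] at hj
  have hbasis := isTranscendenceBasis_of_roots_aux hc ha0 hu hv hj
  have h0 : u ^ a 0 ≠ v ^ a 0 := by
    intro h0
    have := (algebraicIndependent_iff.mp hbasis.1)
      (MvPolynomial.X j ^ a 0 - MvPolynomial.X (Fin.last s) ^ a 0) (by simp [h0, hjl])
    have := congrArg (MvPolynomial.eval (Pi.single (Fin.last s) (1 : ℂ))) this
    simp [hjl.symm, hN.ne'] at this
  exact ⟨h0, isTranscendenceBasis_of_roots_aux hc ha0 hu hv h0⟩

/-- The Galois group of the generic polynomial acts doubly transitively on its roots. -/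
theorem exists_map_pair [IsAlgClosed L] (hc : IsTranscendenceBasis ℂ c) (ha : StrictAnti a)
    (hs : 0 < s) (ha0 : a (Fin.last s) = 0) (hd : Finset.univ.gcd a = 1) {u v u' v' : L}
    (hu : (sparse a c).IsRoot u) (hv : (sparse a c).IsRoot v) (huv : u ≠ v)
    (hu' : (sparse a c).IsRoot u') (hv' : (sparse a c).IsRoot v') (huv' : u' ≠ v') :
    ∃ σ ∈ coeffStabilizer c, σ u = u' ∧ σ v = v' := by
  have hl0 : Fin.last s ≠ 0 := by simp [Fin.ext_iff]; lia
  obtain ⟨h0, ht⟩ := isTranscendenceBasis_of_roots hc ha hs ha0 hd hu hv huv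
  obtain ⟨h0', ht'⟩ := isTranscendenceBasis_of_roots hc ha hs ha0 hd hu' hv' huv'
  obtain ⟨σ, hσ⟩ := exists_algEquiv_of_isTranscendenceBasis ht ht'
  have hσu : σ u = u' := by simpa using hσ 0
  have hσv : σ v = v' := by simpa [hl0] using hσ (Fin.last s)
  have hσi : ∀ i, i ≠ 0 → i ≠ Fin.last s → σ (c i) = c i := fun i h1 h2 => by
    simpa [h1, h2] using hσ i
  rw [IsRoot.def, eval_sparse, ← Finset.add_sum_erase _ _ (Finset.mem_univ (Fin.last s)),
    ← Finset.add_sum_erase _ _ (Finset.mem_erase.mpr ⟨hl0.symm, Finset.mem_univ 0⟩), ha0, pow_zero,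
    mul_one] at hu hv hu' hv'
  have hS : ∀ w, σ (∑ i ∈ (Finset.univ.erase (Fin.last s)).erase 0, c i * w ^ a i) =
      ∑ i ∈ (Finset.univ.erase (Fin.last s)).erase 0, c i * (σ w) ^ a i := by
    intro w
    rw [map_sum]
    refine Finset.sum_congr rfl fun i hi => ?_
    simp only [Finset.mem_erase, Finset.mem_univ, and_true] at hi
    rw [map_mul, map_pow, hσi i hi.1 hi.2]
  have e1 := congrArg σ hu
  have e2 := congrArg σ hv
  rw [map_zero, map_add, map_add, map_mul, map_pow, hS, hσu] at e1
  rw [map_zero, map_add, map_add, map_mul, map_pow, hS, hσv] at e2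
  -- The pairs (σ (c 0), σ (c last)) and (c 0, c last) solve the same nonsingular linear system
  -- given by u' and v'.
  have hσ0 : σ (c 0) = c 0 := by
    refine mul_right_cancel₀ (sub_ne_zero.mpr h0') ?_
    linear_combination e1 - e2 - hu' + hv'
  have hσl : σ (c (Fin.last s)) = c (Fin.last s) := by
    rw [hσ0] at e1
    linear_combination e1 - hu'
  refine ⟨σ, fun i => ?_, hσu, hσv⟩
  by_cases h1 : i = 0
  · rwa [h1]
  by_cases h2 : i = Fin.last s
  · rwa [h2]
  exact hσi i h1 h2

end Generic

end SparsePolynomial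

namespace SparsePolynomial

open Polynomial

/-! ### A specialization with exactly one double root. -/

section DoubleRoot

variable {s : ℕ} {a : Fin (s + 1) → ℕ}

/-- A polynomial with exponents `a j` whose only multiple root is a double root at `1`. -/
noncomputable def doubleRootPoly (a : Fin (s + 1) → ℕ) : ℂ[X] :=
  ∑ j, (C (a j : ℂ) * X ^ a 0 - C (a 0 : ℂ) * X ^ a j + C ((a 0 : ℂ) - a j))

/-- The coefficients of `doubleRootPoly`. -/
noncomputable def doubleRootCoeff (a : Fin (s + 1) → ℕ) (i : Fin (s + 1)) : ℂ :=
  -(a 0 : ℂ) + (if i = 0 then ∑ j, (a j : ℂ) else 0) +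
    if i = Fin.last s then ∑ j, ((a 0 : ℂ) - a j) else 0

theorem sparse_doubleRootCoeff (ha0 : a (Fin.last s) = 0) :
    sparse a (doubleRootCoeff a) = doubleRootPoly a := by
  simp only [sparse, doubleRootCoeff, doubleRootPoly, C_add, add_mul, Finset.sum_add_distrib,
    Finset.sum_sub_distrib]
  simp [apply_ite C, ite_mul, ha0, Finset.sum_mul]
  ring

theorem eq_one_of_norm_le_one {z : ℂ} (hz : ‖z‖ ≤ 1) (hre : z.re = 1) : z = 1 := by
  have h1 : z.re ^ 2 + z.im ^ 2 ≤ 1 := by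
    have := Complex.sq_norm z
    rw [Complex.normSq_apply] at this
    nlinarith [norm_nonneg z]
  have h2 : z.im = 0 := by nlinarith [sq_nonneg z.im]
  exact Complex.ext hre h2

/-- The real parts of the terms are nonnegative and sum to zero. -/
theorem eq_one_of_weighted_sum {ι : Type*} [Fintype ι] {w : ι → ℝ} {z : ι → ℂ}
    (hw : ∀ j, 0 ≤ w j) (hz : ∀ j, ‖z j‖ ≤ 1) (h : ∑ j, (w j : ℂ) * (1 - z j) = 0) {j : ι}
    (hj : w j ≠ 0) : z j = 1 := by
  have hre : ∑ j, w j * (1 - (z j).re) = 0 := by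
    have := congrArg Complex.re h
    simpa [Complex.mul_re] using this
  have hle : ∀ j, (z j).re ≤ 1 := fun j => (Complex.re_le_norm _).trans (hz j)
  have := (Finset.sum_eq_zero_iff_of_nonneg fun i _ =>
    mul_nonneg (hw i) (sub_nonneg.mpr (hle i))).mp hre j (Finset.mem_univ j)
  have h1 := (mul_eq_zero.mp this).resolve_left hj
  exact eq_one_of_norm_le_one (hz j) (by linarith)

theorem exponent_one_pos_lt (ha : StrictAnti a) (ha0 : a (Fin.last s) = 0) (hs : 2 ≤ s) :
    0 < a ⟨1, by lia⟩ ∧ a ⟨1, by lia⟩ < a 0 :=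
  ⟨exponent_pos ha ha0 (by simp [Fin.ext_iff]; lia), ha (by simp [Fin.lt_def])⟩

/-- With N = a 0, the equations F(y) = 0 and y F'(y) = 0 give ∑ a_j (y^N - y^(a_j)) = 0 and ∑ (N -
a_j)(1 - y^(a_j)) = 0. For |y| ≤ 1 the second forces y^(a_j) = 1 for j ≠ 0, then the first gives y^N
= 1, and coprimality gives y = 1. For |y| > 1 the first, divided by y^N, forces y^(a_1) = y^N, which
the absolute values exclude. -/
theorem doubleRootPoly_multiple_root (ha : StrictAnti a) (ha0 : a (Fin.last s) = 0) (hs : 2 ≤ s)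
    (hd : Finset.univ.gcd a = 1) {y : ℂ} (hy : (doubleRootPoly a).eval y = 0)
    (hy' : (derivative (doubleRootPoly a)).eval y = 0) : y = 1 := by
  obtain ⟨h1pos, h1lt⟩ := exponent_one_pos_lt ha ha0 hs
  set i₁ : Fin (s + 1) := ⟨1, by lia⟩
  have hle : ∀ j, a j ≤ a 0 := fun j => ha.antitone (Fin.zero_le j)
  have hN : (a 0 : ℂ) ≠ 0 := Nat.cast_ne_zero.mpr (by lia)
  have hq : ∑ j, (a j : ℂ) * (y ^ a 0 - y ^ a j) = 0 := by
    have hpow : ∀ n : ℕ, y * ((n : ℂ) * y ^ (n - 1)) = n * y ^ n := by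
      intro n
      rcases n with _ | n
      · simp
      · simp only [Nat.add_sub_cancel]; ring
    have h2 : y * (derivative (doubleRootPoly a)).eval y =
        a 0 * ∑ j, (a j : ℂ) * (y ^ a 0 - y ^ a j) := by
      simp only [doubleRootPoly, derivative_sum, eval_finsetSum, Finset.mul_sum, derivative_add,
        derivative_sub, derivative_natCast_mul, derivative_X_pow, derivative_C, eval_add, eval_sub,
        eval_mul, eval_pow, eval_X, eval_zero, eval_natCast, map_natCast]
      refine Finset.sum_congr rfl fun j _ => ?_
      linear_combination (a j : ℂ) * hpow (a 0) - (a 0 : ℂ) * hpow (a j)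
    rw [hy', mul_zero] at h2
    exact (mul_eq_zero.mp h2.symm).resolve_left hN
  have hp : ∑ j, ((a 0 : ℂ) - a j) * (1 - y ^ a j) = 0 := by
    have h2 : (doubleRootPoly a).eval y - ∑ j, (a j : ℂ) * (y ^ a 0 - y ^ a j) =
        ∑ j, ((a 0 : ℂ) - a j) * (1 - y ^ a j) := by
      simp only [doubleRootPoly, eval_finsetSum, eval_add, eval_sub, eval_mul, eval_C, eval_pow,
        eval_X, ← Finset.sum_sub_distrib]
      exact Finset.sum_congr rfl fun j _ => by ring
    rw [← h2, hy, hq, sub_zero]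
  by_cases hy1 : ‖y‖ ≤ 1
  · have hmid : ∀ j, j ≠ 0 → y ^ a j = 1 := by
      intro j hj
      refine eq_one_of_weighted_sum (w := fun j => (a 0 : ℝ) - a j) (z := fun j => y ^ a j)
        (fun j => sub_nonneg.mpr (Nat.cast_le.mpr (hle j)))
        (fun j => by rw [norm_pow]; exact pow_le_one₀ (norm_nonneg _) hy1) ?_ (j := j) ?_
      · simpa using hp
      · have : a j < a 0 := ha (Fin.pos_iff_ne_zero.mpr hj)
        exact (sub_pos.mpr (Nat.cast_lt.mpr this)).ne'
    have h0 : y ^ a 0 = 1 := by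
      have h3 : ∀ j, (a j : ℂ) * (y ^ a 0 - y ^ a j) =
          if j = 0 then 0 else (a j : ℂ) * (y ^ a 0 - 1) := by
        intro j
        split_ifs with h
        · rw [h, sub_self, mul_zero]
        · rw [hmid j h]
      have h4 : ∑ j ∈ Finset.univ.erase 0, (a j : ℂ) * (y ^ a 0 - 1) = 0 := by
        rw [← hq, ← Finset.add_sum_erase _ _ (Finset.mem_univ (0 : Fin (s + 1))), sub_self,
          mul_zero, zero_add]
        refine Finset.sum_congr rfl fun j hj => ?_
        rw [hmid j (Finset.ne_of_mem_erase hj)]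
      rw [← Finset.sum_mul, ← Nat.cast_sum] at h4
      refine sub_eq_zero.mp ((mul_eq_zero.mp h4).resolve_left (Nat.cast_ne_zero.mpr ?_))
      have := Finset.single_le_sum (f := a) (fun _ _ => Nat.zero_le _)
        (show i₁ ∈ Finset.univ.erase 0 by simp [i₁, Fin.ext_iff])
      lia
    by_contra hne
    obtain ⟨j, hj⟩ := pow_ne_pow_of_gcd hd one_ne_zero hne
    rw [one_pow] at hj
    by_cases h : j = 0
    · exact hj (h ▸ h0)
    · exact hj (hmid j h)
  · exfalso
    push Not at hy1
    have hy0 : y ≠ 0 := by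
      rintro rfl
      norm_num at hy1
    have hyN : y ^ a 0 ≠ 0 := pow_ne_zero _ hy0
    have hnorm : ∀ j, ‖y ^ a j / y ^ a 0‖ ≤ 1 := by
      intro j
      rw [norm_div, norm_pow, norm_pow]
      exact div_le_one_of_le₀ (pow_le_pow_right₀ hy1.le (hle j)) (by positivity)
    have h2 := eq_one_of_weighted_sum (w := fun j => (a j : ℝ)) (z := fun j => y ^ a j / y ^ a 0)
      (fun j => Nat.cast_nonneg _) hnorm (by
        have : ∑ j, (a j : ℂ) * (1 - y ^ a j / y ^ a 0) =
            (∑ j, (a j : ℂ) * (y ^ a 0 - y ^ a j)) / y ^ a 0 := by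
          rw [Finset.sum_div]
          refine Finset.sum_congr rfl fun j _ => ?_
          field_simp
        simpa [hq] using this) (j := i₁) (Nat.cast_ne_zero.mpr h1pos.ne')
    have h3 := congrArg norm h2
    rw [norm_one, norm_div, div_eq_one_iff_eq (norm_ne_zero_iff.mpr hyN), norm_pow, norm_pow] at h3
    exact (pow_lt_pow_right₀ hy1 h1lt).ne h3

theorem exists_doubleRootPoly_eq (ha : StrictAnti a) (ha0 : a (Fin.last s) = 0) (hs : 2 ≤ s)
    (hd : Finset.univ.gcd a = 1) : doubleRootCoeff a 0 ≠ 0 ∧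
    ∃ h : ℂ[X], doubleRootPoly a = (X - C 1) ^ 2 * h ∧ h.Separable ∧ h.eval 1 ≠ 0 := by
  obtain ⟨h1pos, h1lt⟩ := exponent_one_pos_lt ha ha0 hs
  set i₁ : Fin (s + 1) := ⟨1, by lia⟩
  have hl : (0 : Fin (s + 1)) ≠ Fin.last s := by simp [Fin.ext_iff]; lia
  have hle : ∀ j, a j ≤ a 0 := fun j => ha.antitone (Fin.zero_le j)
  have hb0 : doubleRootCoeff a 0 ≠ 0 := by
    simp only [doubleRootCoeff, if_true, if_neg hl, add_zero]
    rw [← Finset.add_sum_erase _ _ (Finset.mem_univ (0 : Fin (s + 1))), neg_add_cancel_left,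
      ← Nat.cast_sum]
    have := Finset.single_le_sum (f := a) (fun _ _ => Nat.zero_le _)
        (show i₁ ∈ Finset.univ.erase 0 by simp [i₁, Fin.ext_iff])
    exact Nat.cast_ne_zero.mpr (by lia)
  have hF0 : doubleRootPoly a ≠ 0 := by
    intro h
    rw [← sparse_doubleRootCoeff ha0] at h
    have := coeff_sparse ha.injective (doubleRootCoeff a) 0
    rw [h] at this
    exact hb0 (by simpa using this.symm)
  have hroot : (doubleRootPoly a).IsRoot 1 := by
    simp [doubleRootPoly, eval_finsetSum]
  have hroot' : (derivative (doubleRootPoly a)).IsRoot 1 := by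
    simp [doubleRootPoly, eval_finsetSum, derivative_X_pow, mul_comm]
  obtain ⟨h, hh⟩ := (le_rootMultiplicity_iff hF0).mp
    ((one_lt_rootMultiplicity_iff_isRoot hF0).mpr ⟨hroot, hroot'⟩)
  have hcast : ∀ n : ℕ, (n : ℂ) * ((n - 1 : ℕ) : ℂ) = n * (n - 1) := by
    intro n
    rcases n with _ | n <;> simp
  -- This second derivative is positive because 0 < a_1 < a_0, so the root 1 has multiplicity
  -- exactly two.
  have hsecond : (derivative (derivative (doubleRootPoly a))).eval 1 =
      ((a 0 * ∑ j, a j * (a 0 - a j) : ℕ) : ℂ) := by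
    simp only [doubleRootPoly, derivative_sum, eval_finsetSum, derivative_add,
        derivative_sub, derivative_X_pow, derivative_C, eval_add, eval_sub,
        eval_mul, eval_pow, eval_X, eval_zero, map_natCast, derivative_zero,
        one_pow, mul_one, derivative_natCast_mul, eval_natCast, Nat.cast_mul, Nat.cast_sum,
        Finset.mul_sum]
    refine Finset.sum_congr rfl fun j _ => ?_
    rw [Nat.cast_sub (hle j)]
    linear_combination (a j : ℂ) * hcast (a 0) - (a 0 : ℂ) * hcast (a j)
  have hh1 : h.eval 1 ≠ 0 := by
    intro h0
    have h2 : (derivative (derivative (doubleRootPoly a))).eval 1 = 0 := by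
      rw [hh]
      simp [derivative_mul, derivative_pow, h0]
    rw [hsecond, Nat.cast_eq_zero, Nat.mul_eq_zero] at h2
    have := Finset.single_le_sum (f := fun j => a j * (a 0 - a j)) (fun _ _ => Nat.zero_le _)
        (Finset.mem_univ i₁)
    have h3 : 0 < a i₁ * (a 0 - a i₁) := Nat.mul_pos h1pos (by lia)
    rcases h2 with h2 | h2 <;> lia
  refine ⟨hb0, h, hh, ?_, hh1⟩
  rw [Polynomial.Separable, Polynomial.isCoprime_iff_aeval_ne_zero_of_isAlgClosed ℂ ℂ]
  intro y
  by_contra! hy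
  simp only [coe_aeval_eq_eval] at hy
  have : y = 1 := by
    refine doubleRootPoly_multiple_root ha ha0 hs hd ?_ ?_
    · rw [hh, eval_mul, hy.1, mul_zero]
    · rw [hh, derivative_mul, eval_add, eval_mul, eval_mul, hy.1, hy.2, mul_zero, mul_zero,
        add_zero]
  rw [this] at hy
  exact hh1 hy.1

end DoubleRoot

/-! ### The full symmetric group on the roots. -/

section Symmetric

variable {s : ℕ} {a : Fin (s + 1) → ℕ} {L : Type*} [Field L] [Algebra ℂ L]
  {c : Fin (s + 1) → L}

/-- The permutations of the roots induced by automorphisms fixing the coefficients. -/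
def rootPermSubgroup (a : Fin (s + 1) → ℕ) (c : Fin (s + 1) → L) :
    Subgroup (Equiv.Perm {u : L // (sparse a c).IsRoot u}) where
  carrier := {π | ∃ σ ∈ coeffStabilizer c, ∀ u : {u : L // (sparse a c).IsRoot u}, σ u = (π u : L)}
  mul_mem' := by
    rintro π ρ ⟨σ, hσ, h⟩ ⟨τ, hτ, h'⟩
    exact ⟨σ * τ, mul_mem hσ hτ, fun u => by
      rw [AlgEquiv.mul_apply, h', h, Equiv.Perm.mul_apply]⟩
  one_mem' := ⟨1, one_mem _, fun u => rfl⟩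
  inv_mem' := by
    rintro π ⟨σ, hσ, h⟩
    refine ⟨σ⁻¹, inv_mem hσ, fun u => ?_⟩
    rw [AlgEquiv.aut_inv, AlgEquiv.symm_apply_eq, h, ← Equiv.Perm.mul_apply, mul_inv_cancel, Equiv.Perm.one_apply]

theorem exists_rootPerm {σ : L ≃ₐ[ℂ] L} (hσ : σ ∈ coeffStabilizer c) :
    ∃ π ∈ rootPermSubgroup a c, ∀ u : {u : L // (sparse a c).IsRoot u}, σ u = (π u : L) := by
  let π : Equiv.Perm {u : L // (sparse a c).IsRoot u} :=
    { toFun := fun u => ⟨σ u, isRoot_apply hσ u.2⟩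
      invFun := fun u => ⟨σ⁻¹ u, isRoot_apply (inv_mem hσ) u.2⟩
      left_inv := fun u => Subtype.ext (by simp [AlgEquiv.aut_inv])
      right_inv := fun u => Subtype.ext (by simp [AlgEquiv.aut_inv]) }
  exact ⟨π, ⟨σ, hσ, fun u => rfl⟩, fun u => rfl⟩

/-- The Galois group of the generic polynomial with coprime exponents is the full symmetric
group. -/
theorem rootPermSubgroup_eq_top [IsAlgClosed L] (hc : IsTranscendenceBasis ℂ c) (ha : StrictAnti a)
    (ha0 : a (Fin.last s) = 0) (hs : 2 ≤ s) (hd : Finset.univ.gcd a = 1) :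
    rootPermSubgroup a c = ⊤ := by
  classical
  obtain ⟨hb0, h, hh, hsep, hh1⟩ := exists_doubleRootPoly_eq ha ha0 hs hd
  have hc0 : c 0 ≠ 0 := hc.1.ne_zero 0
  obtain ⟨-, σ, hσ, x₀, hroot, hinj, hper, hall⟩ := exists_cycle hc two_ne_zero
    ((sparse_doubleRootCoeff ha0).trans hh) hsep hh1 (eval_generic_ne_zero hc.1 ha0 1)
    (by rw [natDegree_sparse ha hb0, natDegree_sparse ha hc0])
  have hf0 : sparse a c ≠ 0 := by
    intro h0
    have := coeff_sparse ha.injective c 0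
    rw [h0] at this
    exact hc0 (by simpa using this.symm)
  have : Finite {u : L // (sparse a c).IsRoot u} :=
    Set.Finite.to_subtype ((sparse a c).roots.toFinset.finite_toSet.subset fun u hu => by
      simpa [hf0] using show (sparse a c).IsRoot u from hu)
  let x : {u : L // (sparse a c).IsRoot u} := ⟨x₀, by simpa using hroot 0⟩
  let y : {u : L // (sparse a c).IsRoot u} := ⟨σ x₀, by simpa using hroot 1⟩
  have hxy : x ≠ y := by
    intro h
    have := hinj 0 (by norm_num) 1 (by norm_num) (by simpa [x, y] using h)
    norm_num at this
  have hyx : σ (σ x₀) = x₀ := by simpa [pow_two] using hper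
  have hswap : Equiv.swap x y ∈ rootPermSubgroup a c := by
    refine ⟨σ, hσ, fun u => ?_⟩
    by_cases hux : u = x
    · rw [hux, Equiv.swap_apply_left]
    by_cases huy : u = y
    · rw [huy, Equiv.swap_apply_right]
      exact hyx
    rw [Equiv.swap_apply_of_ne_of_ne hux huy]
    refine (hall u u.2).resolve_left ?_
    rintro ⟨j, hj, he⟩
    interval_cases j
    · exact hux (Subtype.ext (by simpa using he))
    · exact huy (Subtype.ext (by simpa using he))
  -- Double transitivity conjugates the one transposition found into every other.
  rw [eq_top_iff, ← Equiv.Perm.closure_isSwap, Subgroup.closure_le]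
  rintro _ ⟨u, v, huv, rfl⟩
  obtain ⟨τ, hτ, hτu, hτv⟩ := exists_map_pair hc ha (by lia) ha0 hd x.2 y.2
    (fun h => hxy (Subtype.ext h)) u.2 v.2 (fun h => huv (Subtype.ext h))
  obtain ⟨π, hπ, h⟩ := exists_rootPerm (a := a) hτ
  have h1 : u = π x := Subtype.ext (by rw [← h, hτu])
  have h2 : v = π y := Subtype.ext (by rw [← h, hτv])
  rw [h1, h2, Equiv.swap_apply_apply]
  exact mul_mem (mul_mem hπ hswap) (inv_mem hπ)

end Symmetric

end SparsePolynomial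

namespace SparsePolynomial

open Polynomial

/-! ### Independent rotation of the d-th roots of the roots. -/

section Rotation

variable {s : ℕ} {a : Fin (s + 1) → ℕ} {L : Type*} [Field L] [Algebra ℂ L] {c : Fin (s + 1) → L}

/-- The coefficients of `X ^ a 0 - X ^ a i`, or of `X ^ a 0` if `i = 0`. -/
noncomputable def binomialCoeff (i j : Fin (s + 1)) : ℂ :=
  (if j = 0 then 1 else 0) - if j = i ∧ i ≠ 0 then 1 else 0

theorem exists_sparse_binomialCoeff_eq (ha : StrictAnti a) (i : Fin (s + 1)) :
    ∃ h : ℂ[X], sparse a (binomialCoeff i) = (X - C 0) ^ a i * h ∧ h.Separable ∧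
      h.eval 0 ≠ 0 := by
  have hsum : sparse a (binomialCoeff i) = X ^ a 0 - if i ≠ 0 then X ^ a i else 0 := by
    simp only [sparse, binomialCoeff, C_sub, sub_mul, Finset.sum_sub_distrib]
    congr 1
    · simp [apply_ite C]
    · by_cases h : i = 0 <;> simp [h, apply_ite C]
  rw [hsum]
  by_cases h : i = 0
  · refine ⟨1, by simp [h], separable_one, by simp⟩
  · have hlt : a i < a 0 := ha (Fin.pos_iff_ne_zero.mpr h)
    refine ⟨X ^ (a 0 - a i) - C 1, ?_, separable_X_pow_sub_C 1 ?_ one_ne_zero, ?_⟩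
    · rw [if_pos h, C_0, sub_zero, mul_sub, ← pow_add, Nat.add_sub_cancel' hlt.le]
      simp
    · exact Nat.cast_ne_zero.mpr (by lia)
    · simp [zero_pow (show a 0 - a i ≠ 0 by lia)]

theorem binomialCoeff_zero_ne_zero (i : Fin (s + 1)) : (binomialCoeff i 0) ≠ 0 := by
  by_cases h : i = 0 <;> simp [binomialCoeff, h, eq_comm]

/-- Degenerating the generic polynomial to `X ^ a 0 - X ^ a i` gives an `a i`-cycle on its
roots. -/
theorem exists_monomial_cycle [IsAlgClosed L] (hc : IsTranscendenceBasis ℂ c) (ha : StrictAnti a)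
    (ha0 : a (Fin.last s) = 0) {i : Fin (s + 1)} (hi : i ≠ Fin.last s) :
    (sparse a c).roots.Nodup ∧
    ∃ σ ∈ coeffStabilizer c, ∃ x₀ : L, (∀ j : ℕ, (sparse a c).IsRoot ((σ ^ j) x₀)) ∧
      (∀ k < a i, ∀ j < a i, (σ ^ k) x₀ = (σ ^ j) x₀ → k = j) ∧ (σ ^ a i) x₀ = x₀ ∧
      ∀ x, (sparse a c).IsRoot x → (∃ j < a i, x = (σ ^ j) x₀) ∨ σ x = x := by
  obtain ⟨h, hh, hsep, h0⟩ := exists_sparse_binomialCoeff_eq ha i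
  exact exists_cycle hc (exponent_pos ha ha0 hi).ne' hh hsep h0 (eval_generic_ne_zero hc.1 ha0 0)
    (by rw [natDegree_sparse ha (binomialCoeff_zero_ne_zero i),
          natDegree_sparse ha (hc.1.ne_zero 0)])

theorem sparse_ne_zero (hc : AlgebraicIndependent ℂ c) (ha : StrictAnti a) : sparse a c ≠ 0 := by
  intro h0
  have := coeff_sparse ha.injective c 0
  rw [h0] at this
  exact hc.ne_zero 0 (by simpa using this.symm)

theorem finite_roots (hc : AlgebraicIndependent ℂ c) (ha : StrictAnti a) :
    Finite {u : L // (sparse a c).IsRoot u} :=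
  Set.Finite.to_subtype ((sparse a c).roots.finite_toSet.subset fun u hu => by
    simpa [sparse_ne_zero hc ha] using show (sparse a c).IsRoot u from hu)

theorem card_roots_generic [IsAlgClosed L] (hc : IsTranscendenceBasis ℂ c) (ha : StrictAnti a)
    (hs : 0 < s) (ha0 : a (Fin.last s) = 0) :
    Nat.card {u : L // (sparse a c).IsRoot u} = a 0 := by
  classical
  obtain ⟨hnd, -⟩ := exists_monomial_cycle hc ha ha0 (i := 0) (by simp [Fin.ext_iff]; lia)
  rw [← natDegree_sparse ha (hc.1.ne_zero 0), (IsAlgClosed.splits (sparse a c)).natDegree_eq_card_roots,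
    ← Multiset.toFinset_card_of_nodup hnd]
  refine Nat.subtype_card _ fun u => ?_
  rw [Multiset.mem_toFinset, mem_roots (sparse_ne_zero hc.1 ha)]

/-- The exponents `e` for which some automorphism fixing the coefficients multiplies each `d`-th
root of a root `u` by `ζ ^ e u`. -/
def rotationSubgroup (a : Fin (s + 1) → ℕ) (c : Fin (s + 1) → L) (d : ℕ) {ζ : ℂ} (hζ : ζ ≠ 0) :
    AddSubgroup ({u : L // (sparse a c).IsRoot u} → ℤ) where
  carrier := {e | ∃ τ ∈ coeffStabilizer c, ∀ (u : {u : L // (sparse a c).IsRoot u}) (x : L),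
    x ^ d = u → τ x = algebraMap ℂ L (ζ ^ e u) * x}
  add_mem' := by
    rintro e e' ⟨τ, hτ, h⟩ ⟨τ', hτ', h'⟩
    refine ⟨τ * τ', mul_mem hτ hτ', fun u x hx => ?_⟩
    rw [AlgEquiv.mul_apply, h' u x hx, map_mul, AlgEquiv.commutes, h u x hx, Pi.add_apply,
      zpow_add₀ hζ, map_mul]
    ring
  zero_mem' := ⟨1, one_mem _, fun u x _ => by simp⟩
  neg_mem' := by
    rintro e ⟨τ, hτ, h⟩
    refine ⟨τ⁻¹, inv_mem hτ, fun u x hx => ?_⟩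
    rw [AlgEquiv.aut_inv, AlgEquiv.symm_apply_eq, map_mul, AlgEquiv.commutes, h u x hx,
      ← mul_assoc, ← map_mul, Pi.neg_apply, ← zpow_add₀ hζ]
    simp

/-- Conjugating a rotation by an automorphism that induces π permutes its exponents by π. -/
theorem comp_mem_rotationSubgroup {d : ℕ} {ζ : ℂ} (hζ : ζ ≠ 0)
    (htop : rootPermSubgroup a c = ⊤) {e : {u : L // (sparse a c).IsRoot u} → ℤ}
    (he : e ∈ rotationSubgroup a c d hζ) (π : Equiv.Perm {u : L // (sparse a c).IsRoot u}) :
    e ∘ π ∈ rotationSubgroup a c d hζ := by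
  obtain ⟨τ, hτ, h⟩ := he
  obtain ⟨σ, hσ, hπ⟩ : π ∈ rootPermSubgroup a c := htop ▸ Subgroup.mem_top π
  refine ⟨σ⁻¹ * τ * σ, mul_mem (mul_mem (inv_mem hσ) hτ) hσ, fun u x hx => ?_⟩
  rw [AlgEquiv.mul_apply, AlgEquiv.mul_apply, AlgEquiv.aut_inv, AlgEquiv.symm_apply_eq,
    h (π u) (σ x) (by rw [← map_pow, hx, hπ]), map_mul, AlgEquiv.commutes, Function.comp_apply]

theorem exists_eq_pow_mul {d : ℕ} (hd : d ≠ 0) {ζ : ℂ} (hζ : IsPrimitiveRoot ζ d) {x y : L}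
    (hy : y ≠ 0) (hxy : x ^ d = y ^ d) : ∃ k < d, x = algebraMap ℂ L (ζ ^ k) * y := by
  have : NeZero d := ⟨hd⟩
  obtain ⟨k, hk, h⟩ := (hζ.map_of_injective (algebraMap ℂ L).injective).eq_pow_of_pow_eq_one
    (ξ := x / y) (by rw [div_pow, hxy, div_self (pow_ne_zero _ hy)])
  exact ⟨k, hk, by rw [map_pow, h, div_mul_cancel₀ _ hy]⟩

theorem eval_sparse_mul {R : Type*} [CommSemiring R] {c : Fin (s + 1) → R} {d : ℕ} (x : R) :
    (sparse (fun j => d * a j) c).eval x = (sparse a c).eval (x ^ d) := by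
  simp [eval_sparse, pow_mul]

/-- Some automorphism rotates the `d`-th roots of exactly `a i` of the roots. -/
theorem exists_indicator_mem_rotationSubgroup [IsAlgClosed L] (hc : IsTranscendenceBasis ℂ c)
    (ha : StrictAnti a) (ha0 : a (Fin.last s) = 0) {d : ℕ} (hd : d ≠ 0) {ζ : ℂ}
    (hζ : IsPrimitiveRoot ζ d) {i : Fin (s + 1)} (hi : i ≠ Fin.last s) :
    ∃ S : Finset {u : L // (sparse a c).IsRoot u}, S.card = a i ∧
      (S : Set _).indicator 1 ∈ rotationSubgroup a c d (hζ.ne_zero hd) := by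
  classical
  set f := sparse (fun j => d * a j) c with hf
  obtain ⟨-, σ, hσ, x₀, hroot, hinj, hper, hall⟩ := exists_monomial_cycle hc
    (a := fun j => d * a j) (fun j k h => Nat.mul_lt_mul_of_pos_left (ha h) (Nat.pos_of_ne_zero hd))
    (by simp [ha0]) hi
  set m := d * a i with hm
  have hm0 : 0 < m := Nat.mul_pos (Nat.pos_of_ne_zero hd) (exponent_pos ha ha0 hi)
  have hne : ∀ j : ℕ, (σ ^ j) x₀ ≠ 0 := fun j =>
    root_ne_zero hc.1 (by simp [ha0]) (hroot j)
  -- The root ζ x₀ must lie in the cycle of x₀: roots outside it are fixed by σ, but σ moves x₀ and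
  -- hence ζ x₀. The case d = 1 is separate because the cycle may then have length one.
  obtain ⟨t, ht⟩ : ∃ t : ℕ, (σ ^ t) x₀ = algebraMap ℂ L ζ * x₀ := by
    by_cases hd1 : d = 1
    · subst hd1
      exact ⟨0, by simp [IsPrimitiveRoot.one_right_iff.mp hζ]⟩
    have hr : f.IsRoot (algebraMap ℂ L ζ * x₀) := by
      have := hroot 0
      rw [IsRoot.def, eval_sparse_mul] at this ⊢
      rw [mul_pow, ← map_pow, hζ.pow_eq_one, map_one, one_mul]
      simpa using this
    rcases hall _ hr with ⟨j, -, hj⟩ | hfix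
    · exact ⟨j, hj.symm⟩
    · exfalso
      rw [map_mul, AlgEquiv.commutes] at hfix
      have h1 := mul_left_cancel₀ (by simpa using hζ.ne_zero hd) hfix
      have h2 : 1 < m := by
        have := exponent_pos ha ha0 hi
        have : 2 ≤ d := by lia
        nlinarith
      have := hinj 1 h2 0 hm0 (by simpa using h1)
      lia
  have hmod : ∀ j : ℕ, (σ ^ (j % m)) x₀ = (σ ^ j) x₀ := by
    intro j
    conv_rhs => rw [← Nat.mod_add_div j m, pow_add, AlgEquiv.mul_apply, pow_mul]
    congr 1
    induction j / m with
    | zero => simp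
    | succ q ih => rw [pow_succ, AlgEquiv.mul_apply, hper, ← ih]
  have hrot : ∀ k j : ℕ, (σ ^ (t * k + j)) x₀ = algebraMap ℂ L (ζ ^ k) * (σ ^ j) x₀ := by
    intro k j
    induction k with
    | zero => simp
    | succ k ih =>
      rw [mul_add, mul_one, add_right_comm, pow_add, AlgEquiv.mul_apply, ht, map_mul,
        AlgEquiv.commutes, ih, pow_succ', map_mul, mul_assoc]
  let O : Finset L := (Finset.range m).image fun j => (σ ^ j) x₀
  have hO : ∀ j : ℕ, (σ ^ j) x₀ ∈ O := fun j =>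
    Finset.mem_image.mpr ⟨j % m, Finset.mem_range.mpr (Nat.mod_lt j hm0), hmod j⟩
  have hOc : O.card = m := by
    rw [Finset.card_image_of_injOn, Finset.card_range]
    intro k hk j hj hkj
    exact hinj k (by simpa using hk) j (by simpa using hj) hkj
  have hu : ∀ j : ℕ, (sparse a c).IsRoot (((σ ^ j) x₀) ^ d) := fun j => by
    have := hroot j
    rwa [IsRoot.def, eval_sparse_mul] at this
  have hOd : ∀ (x : L) (j : ℕ), x ^ d = ((σ ^ j) x₀) ^ d → x ∈ O := by
    intro x j hx
    obtain ⟨k, -, rfl⟩ := exists_eq_pow_mul hd hζ (hne j) hx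
    rw [← hrot]
    exact hO _
  let S : Finset {u : L // (sparse a c).IsRoot u} :=
    (Finset.range m).image fun j => ⟨((σ ^ j) x₀) ^ d, hu j⟩
  have hS : ∀ (u : {u : L // (sparse a c).IsRoot u}) (x : L), x ^ d = u → (u ∈ S ↔ x ∈ O) := by
    intro u x hx
    constructor
    · intro h
      obtain ⟨j, -, rfl⟩ := Finset.mem_image.mp h
      exact hOd x j hx
    · intro h
      obtain ⟨j, hj, rfl⟩ := Finset.mem_image.mp h
      exact Finset.mem_image.mpr ⟨j, hj, Subtype.ext hx⟩
  refine ⟨S, ?_, σ ^ t, Subgroup.pow_mem _ hσ t, ?_⟩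
  · have hsum : O.card = ∑ u ∈ S.image Subtype.val, {x ∈ O | x ^ d = u}.card := by
      refine Finset.card_eq_sum_card_fiberwise fun x hx => ?_
      obtain ⟨j, hj, rfl⟩ := Finset.mem_image.mp hx
      exact Finset.mem_coe.mpr (Finset.mem_image.mpr
        ⟨⟨_, hu j⟩, Finset.mem_image.mpr ⟨j, hj, rfl⟩, rfl⟩)
    have hfib : ∀ u ∈ S.image Subtype.val, {x ∈ O | x ^ d = u}.card = d := by
      intro u hu'
      obtain ⟨w, hw, rfl⟩ := Finset.mem_image.mp hu'
      obtain ⟨j, hj, rfl⟩ := Finset.mem_image.mp hw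
      have : {x ∈ O | x ^ d = ((σ ^ j) x₀) ^ d} =
          (Finset.range d).image fun k => algebraMap ℂ L (ζ ^ k) * (σ ^ j) x₀ := by
        ext x
        rw [Finset.mem_filter]
        constructor
        · rintro ⟨-, hx⟩
          obtain ⟨k, hk, rfl⟩ := exists_eq_pow_mul hd hζ (hne j) hx
          exact Finset.mem_image_of_mem _ (Finset.mem_range.mpr hk)
        · intro hx
          obtain ⟨k, -, rfl⟩ := Finset.mem_image.mp hx
          refine ⟨by rw [← hrot]; exact hO _, ?_⟩
          rw [mul_pow, ← map_pow, ← pow_mul, mul_comm k, pow_mul, hζ.pow_eq_one, one_pow, map_one,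
            one_mul]
      rw [this, Finset.card_image_of_injOn, Finset.card_range]
      intro k hk l hl hkl
      have h1 := (algebraMap ℂ L).injective (mul_right_cancel₀ (hne j) hkl)
      exact hζ.pow_inj (by simpa using hk) (by simpa using hl) h1
    rw [Finset.sum_congr rfl hfib, Finset.sum_const, smul_eq_mul, hOc,
      Finset.card_image_of_injective _ Subtype.val_injective, hm, mul_comm] at hsum
    exact (Nat.eq_of_mul_eq_mul_right (Nat.pos_of_ne_zero hd) hsum).symm
  · intro u x hx
    by_cases h : u ∈ S
    · rw [Set.indicator_of_mem (by exact h), Pi.one_apply, zpow_one]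
      obtain ⟨j, hj, rfl⟩ := Finset.mem_image.mp ((hS u x hx).mp h)
      have := hrot 1 j
      rwa [mul_one, pow_one, pow_add, AlgEquiv.mul_apply] at this
    · rw [Set.indicator_of_notMem (by exact h), zpow_zero, map_one, one_mul]
      have hxr : f.IsRoot x := by
        rw [IsRoot.def, hf, eval_sparse_mul, hx]
        exact u.2
      have hfix := (hall x hxr).resolve_left (by
        rintro ⟨j, -, rfl⟩
        exact h ((hS u _ hx).mpr (hO j)))
      clear ht hrot
      induction t with
      | zero => rfl
      | succ t ih => rw [pow_succ, AlgEquiv.mul_apply, hfix, ih]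

/-- An indicator of a set of size a_1, neither empty nor full, minus its image under a swap gives a
difference δ_v - δ_w, and permutations give all such differences. Modulo these an indicator of size
a_i is a_i δ_u, and the a_i are coprime. -/
theorem single_mem_rotationSubgroup [IsAlgClosed L] [DecidableEq {u : L // (sparse a c).IsRoot u}]
    (hc : IsTranscendenceBasis ℂ c)
    (ha : StrictAnti a) (ha0 : a (Fin.last s) = 0) (hs : 2 ≤ s) (hgcd : Finset.univ.gcd a = 1)
    {d : ℕ} (hd : d ≠ 0) {ζ : ℂ} (hζ : IsPrimitiveRoot ζ d) :
    ∀ (u : {u : L // (sparse a c).IsRoot u}) (k : ℤ),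
    Pi.single u k ∈ rotationSubgroup a c d (hζ.ne_zero hd) := by
  set U := {u : L // (sparse a c).IsRoot u}
  set E := rotationSubgroup a c d (hζ.ne_zero hd)
  have htop := rootPermSubgroup_eq_top hc ha ha0 hs hgcd
  have : Finite U := finite_roots hc.1 ha
  have hcard : Nat.card U = a 0 := card_roots_generic hc ha (by lia) ha0
  obtain ⟨h1pos, h1lt⟩ := exponent_one_pos_lt ha ha0 hs
  have hdiff : ∀ v w : U, (Pi.single v 1 - Pi.single w 1 : U → ℤ) ∈ E := by
    obtain ⟨S, hSc, hS⟩ := exists_indicator_mem_rotationSubgroup hc ha ha0 hd hζ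
      (i := ⟨1, by lia⟩) (by simp [Fin.ext_iff]; lia)
    obtain ⟨v₀, hv₀⟩ := Finset.card_pos.mp (hSc ▸ h1pos)
    obtain ⟨w₀, hw₀⟩ : ∃ w, w ∉ S := by
      by_contra! hall
      have := Fintype.ofFinite U
      have h2 : S = Finset.univ := Finset.eq_univ_iff_forall.mpr hall
      rw [h2, Finset.card_univ, ← Nat.card_eq_fintype_card, hcard] at hSc
      lia
    have hvw₀ : v₀ ≠ w₀ := by
      rintro rfl
      exact hw₀ hv₀
    have h3 : (Pi.single v₀ 1 - Pi.single w₀ 1 : U → ℤ) ∈ E := by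
      have h4 := sub_mem hS (comp_mem_rotationSubgroup _ htop hS (Equiv.swap v₀ w₀))
      convert h4 using 1
      ext x
      simp only [Pi.sub_apply, Function.comp_apply, Pi.single_apply, Set.indicator_apply,
        Finset.mem_coe, Pi.one_apply]
      by_cases hxv : x = v₀
      · rw [hxv, Equiv.swap_apply_left]
        simp [hvw₀, hv₀, hw₀]
      by_cases hxw : x = w₀
      · rw [hxw, Equiv.swap_apply_right]
        simp [hvw₀.symm, hv₀, hw₀]
      rw [Equiv.swap_apply_of_ne_of_ne hxv hxw]
      simp [hxv, hxw]
    intro v w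
    by_cases hvw : v = w
    · rw [hvw, sub_self]
      exact zero_mem E
    obtain ⟨π, hπv, hπw⟩ := MulAction.is_two_pretransitive_iff.mp
      (Equiv.Perm.isMultiplyPretransitive U 2) hvw hvw₀
    have h4 := comp_mem_rotationSubgroup _ htop h3 π
    convert h4 using 1
    rw [Equiv.Perm.smul_def] at hπv hπw
    ext x
    simp only [Pi.sub_apply, Function.comp_apply, Pi.single_apply, ← hπv, ← hπw, π.injective.eq_iff]
  intro u k
  have hmul : ∀ i, (a i : ℤ) • (Pi.single u 1 : U → ℤ) ∈ E := by
    intro i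
    by_cases hi : i = Fin.last s
    · rw [hi, ha0, Nat.cast_zero, zero_smul]
      exact zero_mem E
    obtain ⟨S, hSc, hS⟩ := exists_indicator_mem_rotationSubgroup hc ha ha0 hd hζ hi
    have h5 : (a i : ℤ) • (Pi.single u 1 : U → ℤ) = (S : Set U).indicator 1 -
        ∑ v ∈ S, (Pi.single v 1 - Pi.single u 1 : U → ℤ) := by
      rw [Finset.sum_sub_distrib, Finset.sum_const, hSc]
      have h6 : ∑ v ∈ S, (Pi.single v 1 : U → ℤ) = (S : Set U).indicator 1 := by
        ext x
        simp [Finset.sum_apply, Pi.single_apply, Set.indicator_apply]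
      rw [h6, sub_sub_cancel, natCast_zsmul]
    rw [h5]
    exact sub_mem hS (sum_mem fun v _ => hdiff v u)
  let H : AddSubgroup ℤ := E.comap (AddMonoidHom.mk' (fun k : ℤ => k • (Pi.single u 1 : U → ℤ))
    fun k l => add_smul k l _)
  obtain ⟨g, hg⟩ := Int.subgroup_cyclic H
  rw [← AddSubgroup.zmultiples_eq_closure] at hg
  have hgd : g.natAbs ∣ 1 := by
    rw [← hgcd]
    refine Finset.dvd_gcd fun i _ => ?_
    have : (a i : ℤ) ∈ H := hmul i
    rw [hg, Int.mem_zmultiples_iff] at this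
    simpa using Int.natAbs_dvd_natAbs.mpr this
  have hk : k ∈ H := by
    rw [hg, Int.mem_zmultiples_iff, ← Int.natAbs_dvd]
    rw [Nat.dvd_one.mp hgd]
    simp
  have : k • (Pi.single u 1 : U → ℤ) ∈ E := hk
  convert this using 1
  ext x
  simp [Pi.single_apply]

/-- Automorphisms fixing the coefficients act transitively on families of roots of
`∑ j, c j * X ^ (d * a j)` with pairwise distinct `d`-th powers. -/
theorem exists_map_family [IsAlgClosed L] (hc : IsTranscendenceBasis ℂ c)
    (ha : StrictAnti a) (ha0 : a (Fin.last s) = 0) (hs : 2 ≤ s) (hgcd : Finset.univ.gcd a = 1)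
    {d : ℕ} (hd : d ≠ 0) {κ : Type*} [Finite κ] {x x' : κ → L}
    (hx : ∀ i, (sparse a c).IsRoot (x i ^ d)) (hxi : Function.Injective fun i => x i ^ d)
    (hx' : ∀ i, (sparse a c).IsRoot (x' i ^ d)) (hxi' : Function.Injective fun i => x' i ^ d) :
    ∃ σ ∈ coeffStabilizer c, ∀ i, σ (x i) = x' i := by
  classical
  have hζ := Complex.isPrimitiveRoot_exp d hd
  set ζ := Complex.exp (2 * Real.pi * Complex.I / d)
  set U := {u : L // (sparse a c).IsRoot u}
  have htop := rootPermSubgroup_eq_top hc ha ha0 hs hgcd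
  let φ : κ ↪ U := ⟨fun i => ⟨x i ^ d, hx i⟩, fun i j h => hxi (congrArg Subtype.val h)⟩
  let φ' : κ ↪ U := ⟨fun i => ⟨x' i ^ d, hx' i⟩, fun i j h => hxi' (congrArg Subtype.val h)⟩
  obtain ⟨π, hπ⟩ := Equiv.Perm.exists_smul_eq_embedding φ φ'
  obtain ⟨σ, hσ, hσπ⟩ : π ∈ rootPermSubgroup a c := htop ▸ Subgroup.mem_top π
  have hσx : ∀ i, (σ (x i)) ^ d = x' i ^ d := by
    intro i
    have h1 := congrArg Subtype.val (DFunLike.congr_fun hπ i)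
    have h2 := hσπ (φ i)
    rw [← map_pow]
    exact h2.trans h1
  have hne : ∀ i, σ (x i) ≠ 0 := by
    intro i h0
    have h1 := hσx i
    rw [h0, zero_pow hd] at h1
    exact root_ne_zero hc.1 ha0 (hx' i) h1.symm
  -- σ matches the d-th powers; the exponents k i record the roots of unity still to be corrected,
  -- independently for each i.
  choose k _ hk using fun i => exists_eq_pow_mul hd hζ (hne i) (hσx i).symm
  have := Fintype.ofFinite κ
  have he : (∑ i, Pi.single (φ' i) (k i : ℤ) : U → ℤ) ∈ rotationSubgroup a c d (hζ.ne_zero hd) :=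
    sum_mem fun i _ => single_mem_rotationSubgroup hc ha ha0 hs hgcd hd hζ _ _
  obtain ⟨τ, hτ, h⟩ := he
  refine ⟨τ * σ, mul_mem hτ hσ, fun i => ?_⟩
  rw [AlgEquiv.mul_apply, h (φ' i) (σ (x i)) (hσx i), Finset.sum_apply]
  simp only [Pi.single_apply, φ'.injective.eq_iff]
  rw [Finset.sum_ite_eq]
  simp [hk i]

end Rotation

end SparsePolynomial

namespace SparsePolynomial

open SchurWeyl (S rho)

/-! ### Vandermonde products and divisibility of the determinants. -/

section Vandermonde

theorem map_S {r : ℕ} {A : Type*} [CommRing A] [Algebra ℂ A] (μ : Fin r → ℕ) (t : Fin r → A) :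
    MvPolynomial.aeval t (S μ) = (Matrix.of fun i j => t i ^ μ j).det := by
  rw [S, AlgHom.map_det]
  congr 1
  ext i j
  simp

theorem map_S_smul_rho {s : ℕ} {A : Type*} [CommRing A] [Algebra ℂ A] (d : ℕ)
    (t : Fin (s + 1) → A) : MvPolynomial.aeval t (S (d • rho (s + 1))) =
      ∏ i, ∏ j ∈ Finset.Ioi i, (t i ^ d - t j ^ d) := by
  rw [map_S]
  have : (Matrix.of fun i j => t i ^ (d • rho (s + 1)) j) =
      Matrix.projVandermonde (fun _ => 1) fun i => t i ^ d := by
    ext i j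
    simp only [Matrix.of_apply, Matrix.projVandermonde_apply, one_pow, one_mul, ← pow_mul]
    congr 1
    simp only [Pi.smul_apply, rho, Fin.val_rev, smul_eq_mul]
    congr 1
    lia
  rw [this, Matrix.det_projVandermonde]
  simp

/-- At x_i = 2 ^ i the matrix is a transposed Vandermonde matrix in the distinct numbers 2 ^ μ j. -/
theorem S_ne_zero {r : ℕ} {μ : Fin r → ℕ} (hμ : Function.Injective μ) : S μ ≠ 0 := by
  intro h
  have h1 := map_S (A := ℂ) μ fun i => 2 ^ (i : ℕ)
  rw [h, map_zero] at h1
  have h2 : (Matrix.of fun i j : Fin r => ((2 : ℂ) ^ (i : ℕ)) ^ μ j) =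
      (Matrix.vandermonde fun j => (2 : ℂ) ^ μ j).transpose := by
    ext i j
    simp [Matrix.vandermonde_apply, ← pow_mul, mul_comm]
  rw [h2, Matrix.det_transpose] at h1
  refine Matrix.det_vandermonde_ne_zero_iff.mpr (fun i j hij => hμ ?_) h1.symm
  have : ((2 ^ μ i : ℕ) : ℂ) = (2 ^ μ j : ℕ) := by push_cast; exact hij
  exact Nat.pow_right_injective le_rfl (Nat.cast_injective this)

variable {σ : Type*} [DecidableEq σ]

theorem X_sub_X_dvd_sub_aeval (i j : σ) (p : MvPolynomial σ ℂ) :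
    (MvPolynomial.X i - MvPolynomial.X j : MvPolynomial σ ℂ) ∣
      p - MvPolynomial.aeval (Function.update MvPolynomial.X i (MvPolynomial.X j)) p := by
  rw [← Ideal.mem_span_singleton, ← Ideal.Quotient.eq]
  have : (Ideal.Quotient.mkₐ ℂ (Ideal.span {MvPolynomial.X (R := ℂ) i - MvPolynomial.X j})) =
      (Ideal.Quotient.mkₐ ℂ (Ideal.span {MvPolynomial.X (R := ℂ) i - MvPolynomial.X j})).comp
        (MvPolynomial.aeval (Function.update MvPolynomial.X i (MvPolynomial.X j))) := by
    ext l
    by_cases h : l = i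
    · subst h
      simp only [AlgHom.comp_apply, MvPolynomial.aeval_X, Function.update_self]
      exact Ideal.Quotient.eq.mpr (Ideal.mem_span_singleton_self _)
    · simp [h]
  exact DFunLike.congr_fun this p

theorem X_sub_X_dvd_iff {i j : σ} {p : MvPolynomial σ ℂ} :
    (MvPolynomial.X i - MvPolynomial.X j : MvPolynomial σ ℂ) ∣ p ↔
      MvPolynomial.aeval (Function.update MvPolynomial.X i
        (MvPolynomial.X j : MvPolynomial σ ℂ)) p = 0 := by
  constructor
  · rintro ⟨q, rfl⟩
    by_cases h : j = i
    · subst h; simp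
    · simp [h]
  · intro h
    have := X_sub_X_dvd_sub_aeval i j p
    rwa [h, sub_zero] at this

theorem irreducible_X_sub_X {i j : σ} (hij : i ≠ j) :
    Irreducible (MvPolynomial.X i - MvPolynomial.X j : MvPolynomial σ ℂ) := by
  have hcoeff : MvPolynomial.coeff (Finsupp.single i 1)
      (MvPolynomial.X i - MvPolynomial.X j : MvPolynomial σ ℂ) = 1 := by
    simp [MvPolynomial.coeff_X, Finsupp.single_left_inj, hij.symm]
  apply MvPolynomial.irreducible_of_totalDegree_eq_one
  · refine le_antisymm ?_ ?_
    · refine (MvPolynomial.totalDegree_sub _ _).trans ?_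
      simp
    · have := MvPolynomial.le_totalDegree (p := (MvPolynomial.X i - MvPolynomial.X j :
        MvPolynomial σ ℂ)) (s := Finsupp.single i 1) (by
          rw [MvPolynomial.mem_support_iff, hcoeff]; exact one_ne_zero)
      simpa using this
  · intro x hx
    exact isUnit_of_dvd_one (hcoeff ▸ hx (Finsupp.single i 1))

theorem X_sub_X_dvd_S {r : ℕ} (μ : Fin r → ℕ) {i j : Fin r} (hij : i ≠ j) :
    (MvPolynomial.X i - MvPolynomial.X j) ∣ S μ := by
  rw [X_sub_X_dvd_iff, map_S]
  exact Matrix.det_zero_of_row_eq hij (by ext; simp [hij.symm])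

/-- The factors X_i - X_j, i < j, are irreducible and pairwise relatively prime, and each divides S
μ because setting X_i = X_j makes two rows equal. -/
theorem S_rho_dvd_S {s : ℕ} (μ : Fin (s + 1) → ℕ) : S (rho (s + 1)) ∣ S μ := by
  have h := map_S_smul_rho (s := s) 1 (MvPolynomial.X : _ → MvPolynomial (Fin (s + 1)) ℂ)
  simp only [one_smul, pow_one, MvPolynomial.aeval_X_left, AlgHom.id_apply] at h
  rw [h, Finset.prod_sigma']
  refine Finset.prod_dvd_of_isRelPrime ?_ ?_
  · rintro ⟨i, j⟩ hij ⟨k, l⟩ hkl hne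
    simp only [Finset.coe_sigma, Set.mem_sigma_iff, Finset.mem_coe, Finset.mem_univ, true_and,
      Finset.mem_Ioi] at hij hkl
    change IsRelPrime (_ - _) (_ - _)
    rw [(irreducible_X_sub_X hij.ne).isRelPrime_iff_not_dvd, X_sub_X_dvd_iff]
    simp only [map_sub, MvPolynomial.aeval_X, sub_eq_zero, Function.update_apply]
    intro heq
    apply hne
    split_ifs at heq with h1 h2 h2
    · exact absurd (h1.trans h2.symm) hkl.ne
    · have := MvPolynomial.X_injective heq
      subst h1; subst this; rfl
    · have := MvPolynomial.X_injective heq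
      subst h2; subst this
      exact absurd hij hkl.asymm
    · exact absurd (MvPolynomial.X_injective heq) hkl.ne
  · rintro ⟨i, j⟩ hij
    simp only [Finset.mem_sigma, Finset.mem_univ, true_and, Finset.mem_Ioi] at hij
    exact X_sub_X_dvd_S μ hij.ne

/-- Substitute x_i ↦ x_i ^ d in the case d = 1. -/
theorem S_smul_rho_dvd_S {s : ℕ} (d : ℕ) (μ : Fin (s + 1) → ℕ) :
    S (d • rho (s + 1)) ∣ S (fun j => d * μ j) := by
  have h : ∀ ν : Fin (s + 1) → ℕ, MvPolynomial.expand d (S ν) = S fun j => d * ν j := by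
    intro ν
    change MvPolynomial.aeval _ (S ν) = _
    rw [map_S, S]
    simp [pow_mul]
  have := map_dvd (MvPolynomial.expand d) (S_rho_dvd_S μ)
  rwa [h, h] at this

end Vandermonde

end SparsePolynomial

namespace SparsePolynomial

open Polynomial
open SchurWeyl (S rho)

/-! ### The determinant at a generic point as a generic sparse polynomial. -/

section GenericTuple

theorem det_updateRow_eq_sum {n R : Type*} [Fintype n] [DecidableEq n] [CommRing R]
    (M : Matrix n n R) (i : n) (v : n → R) :
    (M.updateRow i v).det = ∑ j, v j * (M.updateRow i (Pi.single j 1)).det := by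
  rw [Matrix.det_eq_sum_mul_adjugate_row _ i]
  simp [Matrix.adjugate_apply]

variable {s : ℕ} {L : Type*} [Field L]

/-- The cofactors along the last row of the matrix with entries `ξ i ^ μ j`. -/
noncomputable def lastCofactor (μ : Fin (s + 1) → ℕ) (ξ : Fin (s + 1) → L) (j : Fin (s + 1)) : L :=
  ((Matrix.of fun i k => ξ i ^ μ k).updateRow (Fin.last s) (Pi.single j 1)).det

/-- The tuple `ξ` with its last entry replaced by a variable. -/
noncomputable def varLast (ξ : Fin (s + 1) → L) : Fin (s + 1) → L[X] :=
  Function.update (fun i => C (ξ i)) (Fin.last s) X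

variable [Algebra ℂ L]

theorem aeval_varLast_S (μ : Fin (s + 1) → ℕ) (ξ : Fin (s + 1) → L) :
    MvPolynomial.aeval (varLast ξ) (S μ) = sparse μ (lastCofactor μ ξ) := by
  rw [map_S]
  have h : (Matrix.of fun i j => varLast ξ i ^ μ j) =
      ((Matrix.of fun i k => ξ i ^ μ k).map C).updateRow (Fin.last s) fun j => X ^ μ j := by
    ext1 i j
    by_cases hi : i = Fin.last s <;> simp [varLast, hi]
  have h2 : ∀ j, (((Matrix.of fun i k => ξ i ^ μ k).map C).updateRow (Fin.last s)
      (Pi.single j 1)).det = C (lastCofactor μ ξ j) := by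
    intro j
    rw [lastCofactor, RingHom.map_det, RingHom.mapMatrix_apply, Matrix.map_updateRow]
    congr 2
    ext1 k
    by_cases hk : k = j
    · subst hk; simp
    · simp [hk]
  rw [h, det_updateRow_eq_sum, sparse]
  exact Finset.sum_congr rfl fun j _ => by rw [h2, mul_comm]

theorem eval_aeval_varLast (P : MvPolynomial (Fin (s + 1)) ℂ) (ξ : Fin (s + 1) → L) (y : L) :
    (MvPolynomial.aeval (varLast ξ) P).eval y =
      MvPolynomial.aeval (Function.update ξ (Fin.last s) y) P := by
  have : ((aeval y).restrictScalars ℂ).comp (MvPolynomial.aeval (varLast ξ)) =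
      MvPolynomial.aeval (Function.update ξ (Fin.last s) y) := by
    ext i
    by_cases hi : i = Fin.last s
    · subst hi; simp [varLast]
    · simp [varLast, hi]
  exact DFunLike.congr_fun this P

/-- The coefficients of `ξ_s * det (x_i ^ a_j)` with `x_i = ξ i` for `i < s` and `x_s` the
variable. -/
noncomputable def detCoeff (a : Fin (s + 1) → ℕ) (ξ : Fin (s + 1) → L) (j : Fin (s + 1)) : L :=
  ξ (Fin.last s) * lastCofactor a ξ j

theorem sparse_detCoeff (a : Fin (s + 1) → ℕ) (ξ : Fin (s + 1) → L) :
    sparse a (detCoeff a ξ) = C (ξ (Fin.last s)) * MvPolynomial.aeval (varLast ξ) (S a) := by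
  rw [aeval_varLast_S, sparse, sparse, Finset.mul_sum]
  exact Finset.sum_congr rfl fun j _ => by rw [detCoeff, C_mul, mul_assoc]

theorem isRoot_detCoeff (a : Fin (s + 1) → ℕ) (ξ : Fin (s + 1) → L) {i : Fin (s + 1)}
    (hi : i ≠ Fin.last s) : (sparse a (detCoeff a ξ)).IsRoot (ξ i) := by
  rw [IsRoot.def, sparse_detCoeff, eval_mul, eval_aeval_varLast, map_S,
    Matrix.det_zero_of_row_eq hi (by ext; simp [hi]), mul_zero]

theorem aeval_ne_zero {ι : Type*} {ξ : ι → L} (hξ : AlgebraicIndependent ℂ ξ)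
    {p : MvPolynomial ι ℂ} (hp : p ≠ 0) : MvPolynomial.aeval ξ p ≠ 0 := fun h =>
  hp ((algebraicIndependent_iff.mp hξ) p h)

/-- For i < s, ξ_i is a root of the polynomial with coefficients c, hence algebraic over ℂ(c). So
are the cofactors, which involve only these ξ_i, and then ξ_s = c_j / cofactor. The factor ξ_s in c
is essential: the s + 1 cofactors depend on only s parameters. -/
theorem isTranscendenceBasis_detCoeff {a : Fin (s + 1) → ℕ} (ha : StrictAnti a)
    {ξ : Fin (s + 1) → L} (hξ : IsTranscendenceBasis ℂ ξ) :
    IsTranscendenceBasis ℂ (detCoeff a ξ) := by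
  set c := detCoeff a ξ with hc
  refine isTranscendenceBasis_of_isAlgebraic hξ ?_
  let K := IntermediateField.adjoin ℂ (Set.range c)
  let A := algebraicClosure K L
  have hf : (sparse a c).eval (ξ (Fin.last s)) ≠ 0 := by
    rw [sparse_detCoeff, eval_mul, eval_C, eval_aeval_varLast, Function.update_eq_self]
    exact mul_ne_zero (hξ.1.ne_zero _) (aeval_ne_zero hξ.1 (S_ne_zero ha.injective))
  have hcK : ∀ j, c j ∈ K := fun j => IntermediateField.subset_adjoin _ _ ⟨j, rfl⟩
  have hKA : ∀ z ∈ K, z ∈ A := fun z hz => A.algebraMap_mem ⟨z, hz⟩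
  have hA : ∀ i, i ≠ Fin.last s → ξ i ∈ A := by
    intro i hi
    refine mem_algebraicClosure_iff'.mpr (IsAlgebraic.isIntegral ?_)
    refine ⟨sparse a fun j => ⟨c j, hcK j⟩, ?_, ?_⟩
    · intro h0
      apply hf
      have : (sparse a fun j => (⟨c j, hcK j⟩ : K)).map (algebraMap K L) = sparse a c :=
        map_sparse _ _ _
      rw [← this, h0, Polynomial.map_zero, eval_zero]
    · rw [← Polynomial.eval_map_algebraMap, map_sparse]
      exact isRoot_detCoeff a ξ hi
  have hlast : ξ (Fin.last s) ∈ A := by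
    obtain ⟨j, hj⟩ : ∃ j, c j ≠ 0 := by
      by_contra! h0
      apply hf
      simp [eval_sparse, h0]
    have hD : lastCofactor a ξ j ∈ A := by
      rw [lastCofactor, Matrix.det_apply]
      refine sum_mem fun σ _ => zsmul_mem (prod_mem fun k _ => ?_) _
      by_cases hk : σ k = Fin.last s
      · rw [hk, Matrix.updateRow_self, Pi.single_apply]
        split_ifs
        · exact one_mem A
        · exact zero_mem A
      · rw [Matrix.updateRow_ne hk]
        exact pow_mem (hA _ hk) _
    have hD0 : lastCofactor a ξ j ≠ 0 := right_ne_zero_of_mul hj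
    have : ξ (Fin.last s) = c j / lastCofactor a ξ j := by
      rw [eq_div_iff hD0]
      rfl
    rw [this]
    exact div_mem (hKA _ (hcK j)) hD
  intro i
  have : ξ i ∈ A := by
    by_cases hi : i = Fin.last s
    · rwa [hi]
    · exact hA i hi
  exact (mem_algebraicClosure_iff'.mp this).isAlgebraic

end GenericTuple

/-! ### Factors of the quotient, and units among them. -/

section Factor

variable {s : ℕ} {L : Type*} [Field L] [Algebra ℂ L]

/-- Families of roots of `∑ j, c j * X ^ (d * a j)` with pairwise distinct `d`-th powers. -/
def IsAdmissible (a : Fin (s + 1) → ℕ) (c : Fin (s + 1) → L) (d : ℕ) (t : Fin (s + 1) → L) : Prop :=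
  (∀ i, (sparse a c).IsRoot (t i ^ d)) ∧ Function.Injective fun i => t i ^ d

theorem aeval_S_smul_rho_eq_zero_iff {d : ℕ} {t : Fin (s + 1) → L} :
    MvPolynomial.aeval t (S (d • rho (s + 1))) = 0 ↔ ¬ Function.Injective fun i => t i ^ d := by
  rw [map_S_smul_rho, Finset.prod_eq_zero_iff]
  simp only [Finset.prod_eq_zero_iff, Finset.mem_univ, true_and, Finset.mem_Ioi, sub_eq_zero,
    Function.Injective, not_forall]
  constructor
  · rintro ⟨i, j, hij, h⟩
    exact ⟨i, j, h, hij.ne⟩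
  · rintro ⟨i, j, h, hij⟩
    rcases lt_or_gt_of_ne hij with hlt | hlt
    · exact ⟨i, j, hlt, h⟩
    · exact ⟨j, i, hlt, h.symm⟩

/-- One factor of the quotient of determinants vanishes at all admissible families. -/
theorem factor_vanishes [IsAlgClosed L] {a : Fin (s + 1) → ℕ} {c : Fin (s + 1) → L}
    (hc : IsTranscendenceBasis ℂ c) (ha : StrictAnti a) (ha0 : a (Fin.last s) = 0) (hs : 2 ≤ s)
    (hgcd : Finset.univ.gcd a = 1) {d : ℕ} (hd : d ≠ 0) {P Q : MvPolynomial (Fin (s + 1)) ℂ}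
    (hPQ : P * Q * S (d • rho (s + 1)) = S fun j => d * a j) :
    (∀ t, IsAdmissible a c d t → MvPolynomial.aeval t P = 0) ∨
      ∀ t, IsAdmissible a c d t → MvPolynomial.aeval t Q = 0 := by
  have key : ∀ (R : MvPolynomial (Fin (s + 1)) ℂ) (t t' : Fin (s + 1) → L),
      IsAdmissible a c d t → IsAdmissible a c d t' →
      MvPolynomial.aeval t R = 0 → MvPolynomial.aeval t' R = 0 := by
    intro R t t' ht ht' h
    obtain ⟨σ, -, hσ⟩ := exists_map_family hc ha ha0 hs hgcd hd ht.1 ht.2 ht'.1 ht'.2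
    have h1 : MvPolynomial.aeval t' R = σ (MvPolynomial.aeval t R) := by
      have : (σ : L →ₐ[ℂ] L).comp (MvPolynomial.aeval t) = MvPolynomial.aeval t' := by
        ext i
        simp [hσ]
      exact (DFunLike.congr_fun this R).symm
    rw [h1, h, map_zero]
  by_contra! hcon
  obtain ⟨⟨t, ht, hP⟩, t', ht', hQ⟩ := hcon
  have hP' : MvPolynomial.aeval t' P ≠ 0 := fun h => hP (key P t' t ht' ht h)
  have hV : MvPolynomial.aeval t' (S (d • rho (s + 1))) ≠ 0 := fun h =>
    aeval_S_smul_rho_eq_zero_iff.mp h ht'.2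
  have h0 : MvPolynomial.aeval t' (S fun j => d * a j) ≠ 0 := by
    rw [← hPQ, map_mul, map_mul]
    exact mul_ne_zero (mul_ne_zero hP' hQ) hV
  apply h0
  rw [map_S]
  -- That every t' i is a root says that c is a nonzero kernel vector of the matrix.
  refine Matrix.exists_mulVec_eq_zero_iff.mp ⟨c, fun h => hc.1.ne_zero 0 (congrFun h 0), ?_⟩
  ext i
  have := ht'.1 i
  rw [IsRoot.def, eval_sparse] at this
  rw [Pi.zero_apply, ← this]
  simp [Matrix.mulVec, dotProduct, pow_mul, mul_comm]

/-- The complementary factor does not involve the last variable. -/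
theorem cofactor_const [IsAlgClosed L] {a : Fin (s + 1) → ℕ} {ξ : Fin (s + 1) → L}
    (hξ : IsTranscendenceBasis ℂ ξ) (ha : StrictAnti a) (ha0 : a (Fin.last s) = 0) (hs : 2 ≤ s)
    {d : ℕ} (hd : d ≠ 0) {P Q : MvPolynomial (Fin (s + 1)) ℂ}
    (hPQ : P * Q * S (d • rho (s + 1)) = S fun j => d * a j)
    (hP : ∀ t, IsAdmissible a (detCoeff (fun j => d * a j) ξ) d t → MvPolynomial.aeval t P = 0)
    (z : Fin (s + 1) → ℂ) :
    MvPolynomial.eval z Q = MvPolynomial.eval (Function.update z (Fin.last s) 0) Q := by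
  classical
  have hda : StrictAnti fun j => d * a j := fun j k h =>
    Nat.mul_lt_mul_of_pos_left (ha h) (Nat.pos_of_ne_zero hd)
  set c := detCoeff (fun j => d * a j) ξ with hcdef
  have hc : IsTranscendenceBasis ℂ c := isTranscendenceBasis_detCoeff hda hξ
  set f := sparse (fun j => d * a j) c with hf
  set p := MvPolynomial.aeval (varLast ξ) P with hp
  set q := MvPolynomial.aeval (varLast ξ) Q with hq
  set v := MvPolynomial.aeval (varLast ξ) (S (d • rho (s + 1))) with hv
  have hfpq : f = C (ξ (Fin.last s)) * (p * q * v) := by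
    rw [hf, hcdef, sparse_detCoeff, ← hPQ, map_mul, map_mul]
  have hf0 : f ≠ 0 := sparse_ne_zero hc.1 hda
  have hpqv : p * q * v ≠ 0 := right_ne_zero_of_mul (hfpq ▸ hf0)
  have hv0 : v ≠ 0 := right_ne_zero_of_mul hpqv
  have hp0 : p ≠ 0 := left_ne_zero_of_mul (left_ne_zero_of_mul hpqv)
  have hq0 : q ≠ 0 := right_ne_zero_of_mul (left_ne_zero_of_mul hpqv)
  have hdeg : f.natDegree = p.natDegree + q.natDegree + v.natDegree := by
    rw [hfpq, natDegree_C_mul (hξ.1.ne_zero _), natDegree_mul (mul_ne_zero hp0 hq0) hv0,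
      natDegree_mul hp0 hq0]
  have hroot : ∀ x, f.IsRoot x → (sparse a c).IsRoot (x ^ d) := by
    intro x hx
    rwa [IsRoot.def, hf, eval_sparse_mul] at hx
  -- If v(y) ≠ 0, replacing the last entry of ξ by y gives an admissible tuple.
  have hadm : ∀ y, f.IsRoot y → v.eval y ≠ 0 → p.eval y = 0 := by
    intro y hy hvy
    rw [hp, eval_aeval_varLast]
    rw [hv, eval_aeval_varLast, Ne, aeval_S_smul_rho_eq_zero_iff, not_not] at hvy
    refine hP _ ⟨fun i => hroot _ ?_, hvy⟩
    by_cases hi : i = Fin.last s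
    · rw [hi, Function.update_self]
      exact hy
    · rw [Function.update_of_ne hi]
      exact isRoot_detCoeff _ ξ hi
  obtain ⟨hnd, -⟩ := exists_monomial_cycle hc hda (by simp [ha0]) (i := 0)
    (by simp [Fin.ext_iff]; lia)
  have hcard : f.natDegree = f.roots.toFinset.card := by
    rw [Multiset.toFinset_card_of_nodup hnd, (IsAlgClosed.splits f).natDegree_eq_card_roots]
  have hsub : f.roots.toFinset ⊆ p.roots.toFinset ∪ v.roots.toFinset := by
    intro y hy
    rw [Multiset.mem_toFinset, mem_roots hf0] at hy
    rw [Finset.mem_union, Multiset.mem_toFinset, Multiset.mem_toFinset, mem_roots hp0,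
      mem_roots hv0]
    by_cases h : v.eval y = 0
    · exact Or.inr h
    · exact Or.inl (hadm y hy h)
  have hle : f.natDegree ≤ p.natDegree + v.natDegree := by
    rw [hcard]
    refine (Finset.card_le_card hsub).trans ((Finset.card_union_le _ _).trans ?_)
    exact add_le_add ((Multiset.toFinset_card_le _).trans (card_roots' p))
      ((Multiset.toFinset_card_le _).trans (card_roots' v))
  -- deg p + deg q + deg v = deg f ≤ deg p + deg v.
  obtain ⟨b, hb⟩ := natDegree_eq_zero.mp (show q.natDegree = 0 by lia)
  have h1 : MvPolynomial.aeval ξ Q =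
      MvPolynomial.aeval (Function.update ξ (Fin.last s) 0) Q := by
    have e1 := eval_aeval_varLast Q ξ (ξ (Fin.last s))
    have e2 := eval_aeval_varLast Q ξ 0
    rw [← hq, ← hb, eval_C] at e1 e2
    rw [Function.update_eq_self] at e1
    rw [← e1, ← e2]
  let ψ : MvPolynomial (Fin (s + 1)) ℂ →ₐ[ℂ] MvPolynomial (Fin (s + 1)) ℂ :=
    MvPolynomial.aeval (Function.update MvPolynomial.X (Fin.last s) 0)
  have h2 : Q = ψ Q := by
    have hinj : Function.Injective (MvPolynomial.aeval (R := ℂ) ξ) := hξ.1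
    apply hinj
    rw [h1]
    have : (MvPolynomial.aeval (R := ℂ) ξ).comp ψ =
        MvPolynomial.aeval (Function.update ξ (Fin.last s) 0) := by
      ext i
      by_cases hi : i = Fin.last s
      · subst hi; simp [ψ]
      · simp [ψ, hi]
    exact (DFunLike.congr_fun this Q).symm
  have h3 : (MvPolynomial.aeval (R := ℂ) z).comp ψ =
      MvPolynomial.aeval (Function.update z (Fin.last s) 0) := by
    ext i
    by_cases hi : i = Fin.last s
    · subst hi; simp [ψ]
    · simp [ψ, hi]
  have h4 := DFunLike.congr_fun h3 Q
  rw [AlgHom.comp_apply, ← h2] at h4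
  simpa [MvPolynomial.coe_aeval_eq_eval] using h4

theorem rename_S {r : ℕ} (π : Equiv.Perm (Fin r)) (μ : Fin r → ℕ) :
    MvPolynomial.rename π (S μ) = (Equiv.Perm.sign π : ℤ) • S μ := by
  have h : MvPolynomial.rename (R := ℂ) π = MvPolynomial.aeval fun i => MvPolynomial.X (π i) := by
    ext i
    simp
  have h2 := Matrix.det_permute π
    (Matrix.of fun i j : Fin r => (MvPolynomial.X i : MvPolynomial (Fin r) ℂ) ^ μ j)
  rw [h, map_S, zsmul_eq_mul, S, ← h2]
  rfl

theorem eq_C_of_forall_eval_update {ι : Type*} [Fintype ι] [DecidableEq ι] {Q : MvPolynomial ι ℂ}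
    (h : ∀ i z, MvPolynomial.eval z Q = MvPolynomial.eval (Function.update z i 0) Q) :
    Q = MvPolynomial.C (MvPolynomial.eval 0 Q) := by
  have key : ∀ (T : Finset ι) (z : ι → ℂ),
      MvPolynomial.eval z Q = MvPolynomial.eval (fun i => if i ∈ T then 0 else z i) Q := by
    intro T z
    induction T using Finset.induction_on with
    | empty => simp
    | insert i T _ ih =>
      rw [ih, h i]
      congr 2
      ext k
      by_cases hk : k = i
      · simp [hk]
      · simp [hk]
  refine MvPolynomial.funext fun z => ?_
  rw [key Finset.univ z, MvPolynomial.eval_C]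
  simp only [Finset.mem_univ, if_true]
  rfl

/-- If one factor vanishes at all admissible families, the other one is constant. -/
theorem isUnit_of_vanishes [IsAlgClosed L] {a : Fin (s + 1) → ℕ} {ξ : Fin (s + 1) → L}
    (hξ : IsTranscendenceBasis ℂ ξ) (ha : StrictAnti a) (ha0 : a (Fin.last s) = 0) (hs : 2 ≤ s)
    {d : ℕ} (hd : d ≠ 0) {P Q : MvPolynomial (Fin (s + 1)) ℂ}
    (hPQ : P * Q * S (d • rho (s + 1)) = S fun j => d * a j)
    (hP : ∀ t, IsAdmissible a (detCoeff (fun j => d * a j) ξ) d t → MvPolynomial.aeval t P = 0) :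
    IsUnit Q := by
  have hda : Function.Injective fun j => d * a j := fun j k h =>
    ha.injective (Nat.eq_of_mul_eq_mul_left (Nat.pos_of_ne_zero hd) h)
  have hconst : Q = MvPolynomial.C (MvPolynomial.eval 0 Q) := by
    refine eq_C_of_forall_eval_update fun i z => ?_
    let π : Equiv.Perm (Fin (s + 1)) := Equiv.swap i (Fin.last s)
    -- Both determinants change by the same sign, so the permuted factors satisfy the same identity,
    -- and any variable can play the role of the last one.
    have hPQ' : MvPolynomial.rename π P * MvPolynomial.rename π Q * S (d • rho (s + 1)) =
        S fun j => d * a j := by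
      have h1 := congrArg (MvPolynomial.rename π) hPQ
      rw [map_mul, map_mul, rename_S, rename_S, mul_smul_comm] at h1
      have h2 := congrArg (fun w => (Equiv.Perm.sign π : ℤ) • w) h1
      simpa only [smul_smul, ← Units.val_mul, Int.units_mul_self, Units.val_one, one_smul] using h2
    have h := cofactor_const hξ ha ha0 hs hd hPQ' (fun t ht => by
      rw [MvPolynomial.aeval_rename]
      exact hP _ ⟨fun i => ht.1 (π i), ht.2.comp π.injective⟩) (z ∘ π)
    rw [MvPolynomial.eval_rename, MvPolynomial.eval_rename] at h
    have e1 : (z ∘ π) ∘ π = z := by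
      ext k
      simp [π]
    have e2 : Function.update (z ∘ π) (Fin.last s) 0 ∘ π = Function.update z i 0 := by
      ext k
      by_cases hk : k = i
      · simp [hk, π]
      · have : π k ≠ Fin.last s := fun h => hk (by
          have := congrArg π h
          simpa [π] using this)
        simp [hk, this, Function.comp_apply, π]
    rwa [e1, e2] at h
  have hQ0 : Q ≠ 0 := by
    rintro rfl
    rw [mul_zero, zero_mul] at hPQ
    exact S_ne_zero hda hPQ.symm
  rw [hconst] at hQ0 ⊢
  exact (isUnit_iff_ne_zero.mpr fun h => hQ0 (by rw [h, map_zero])).map MvPolynomial.C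

/-- If the two determinants are proportional, the exponents are minimal. -/
theorem eq_rho_of_isUnit {a : Fin (s + 1) → ℕ} {ξ : Fin (s + 1) → L}
    (hξ : IsTranscendenceBasis ℂ ξ) (ha : StrictAnti a)
    {d : ℕ} (hd : d ≠ 0) {P : MvPolynomial (Fin (s + 1)) ℂ} (hP : IsUnit P)
    (hPS : P * S (d • rho (s + 1)) = S fun j => d * a j) : a = rho (s + 1) := by
  have hda : StrictAnti fun j => d * a j := fun j k h =>
    Nat.mul_lt_mul_of_pos_left (ha h) (Nat.pos_of_ne_zero hd)
  have hρ : StrictAnti (rho (s + 1)) := fun j k h => by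
    simp only [rho]
    have := Fin.lt_def.mp h
    have := k.2
    lia
  have hdρ : StrictAnti (d • rho (s + 1)) := fun j k h =>
    Nat.mul_lt_mul_of_pos_left (hρ h) (Nat.pos_of_ne_zero hd)
  have hc := isTranscendenceBasis_detCoeff hda hξ
  -- Comparing degrees in the last variable gives a 0 ≤ s, and a strictly decreasing sequence of s +
  -- 1 naturals starting at most at s is ρ.
  have h1 : (sparse (fun j => d * a j) (detCoeff (fun j => d * a j) ξ)).natDegree = d * a 0 :=
    natDegree_sparse hda (hc.1.ne_zero 0)
  rw [sparse_detCoeff, natDegree_C_mul (hξ.1.ne_zero _), ← hPS, map_mul,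
    natDegree_mul' , natDegree_eq_zero_of_isUnit (hP.map _), zero_add, aeval_varLast_S] at h1
  · have h2 := natDegree_sparse_le hdρ (lastCofactor (d • rho (s + 1)) ξ)
    rw [h1] at h2
    have h3 : a 0 ≤ s := by
      have : d * a 0 ≤ d * s := by simpa [rho] using h2
      exact Nat.le_of_mul_le_mul_left this (Nat.pos_of_ne_zero hd)
    have h4 : ∀ k : ℕ, ∀ hk : k < s + 1, a ⟨k, hk⟩ + k ≤ s := by
      intro k
      induction k with
      | zero => intro _; simpa using h3
      | succ k ih =>
        intro hk
        have h5 := ih (by lia)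
        have h6 : a ⟨k + 1, hk⟩ < a ⟨k, by lia⟩ := ha (by simp [Fin.lt_def])
        lia
    have h7 : ∀ k : ℕ, ∀ hk : k ≤ s, k ≤ a ⟨s - k, by lia⟩ := by
      intro k
      induction k with
      | zero => intro _; exact Nat.zero_le _
      | succ k ih =>
        intro hk
        have h5 := ih (by lia)
        have h6 : a ⟨s - k, by lia⟩ < a ⟨s - (k + 1), by lia⟩ := ha (by simp [Fin.lt_def]; lia)
        lia
    ext j
    have h8 := h4 j j.2
    have h9 := h7 (s - j) (by lia)
    have h10 : (⟨s - (s - j), by lia⟩ : Fin (s + 1)) = j := Fin.ext (by simp; lia)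
    rw [h10] at h9
    simp only [rho, Fin.eta] at *
    lia
  · rw [← leadingCoeff_mul, Ne, leadingCoeff_eq_zero, ← map_mul, hPS]
    intro h0
    have := sparse_ne_zero hc.1 hda
    rw [sparse_detCoeff, h0, mul_zero] at this
    exact this rfl

end Factor

/-! ### Existence of a generic point, and conclusion. -/

theorem exists_transcendenceBasis_algClosed (s : ℕ) :
    ∃ ξ : Fin (s + 1) → AlgebraicClosure (FractionRing (MvPolynomial (Fin (s + 1)) ℂ)),
      IsTranscendenceBasis ℂ ξ := by
  let R := MvPolynomial (Fin (s + 1)) ℂ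
  let F := FractionRing R
  have hX : IsTranscendenceBasis ℂ (MvPolynomial.X : Fin (s + 1) → R) :=
    IsTranscendenceBasis.mvPolynomial _ _
  have : Algebra.IsAlgebraic R F := IsLocalization.isAlgebraic F (nonZeroDivisors R)
  exact ⟨_, (hX.algebraMap_comp (A := F)).algebraMap_comp (A := AlgebraicClosure F)⟩

/-- The quotient of determinants is irreducible. -/
theorem irreducible_quotient {s : ℕ} {a : Fin (s + 1) → ℕ} (ha : StrictAnti a)
    (ha0 : a (Fin.last s) = 0) (hs : 2 ≤ s) (hgcd : Finset.univ.gcd a = 1) {d : ℕ} (hd : d ≠ 0)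
    (hρ : a ≠ rho (s + 1)) {P : MvPolynomial (Fin (s + 1)) ℂ}
    (hP : P * S (d • rho (s + 1)) = S fun j => d * a j) : Irreducible P := by
  obtain ⟨ξ, hξ⟩ := exists_transcendenceBasis_algClosed s
  have hda : StrictAnti fun j => d * a j := fun j k h =>
    Nat.mul_lt_mul_of_pos_left (ha h) (Nat.pos_of_ne_zero hd)
  refine ⟨fun hu => hρ (eq_rho_of_isUnit hξ ha hd hu hP), ?_⟩
  rintro A B rfl
  rcases factor_vanishes (isTranscendenceBasis_detCoeff hda hξ) ha ha0 hs hgcd hd hP with h | h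
  · exact Or.inr (isUnit_of_vanishes hξ ha ha0 hs hd hP h)
  · exact Or.inl (isUnit_of_vanishes hξ ha ha0 hs hd (by rwa [mul_comm B A]) h)

end SparsePolynomial

theorem theorem1 (r : ℕ) (hr : 0 < r) (a : SchurWeyl.Weight r)
    (h_anti : StrictAnti a) (h_last : a ⟨r - 1, Nat.sub_one_lt_of_lt hr⟩ = 0)
    (h_rho : ¬ ∃ k : ℕ, a = k • SchurWeyl.rho r) :
    ∃ P : MvPolynomial (Fin r) ℂ,
      algebraMap (MvPolynomial (Fin r) ℂ) (FractionRing (MvPolynomial (Fin r) ℂ)) P =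
        SchurWeyl.C a ∧
      Irreducible P := by
  obtain ⟨s, rfl⟩ : ∃ s, r = s + 1 := ⟨r - 1, by lia⟩
  have ha0 : a (Fin.last s) = 0 := h_last
  -- For r = 1 and r = 2 every weight ending in 0 is a multiple of ρ.
  have hs : 2 ≤ s := by
    by_contra hlt
    apply h_rho
    refine ⟨a 0, ?_⟩
    have : s = 0 ∨ s = 1 := by lia
    rcases this with rfl | rfl
    · ext j
      fin_cases j
      simpa [SchurWeyl.rho] using ha0
    · ext j
      fin_cases j
      · simp [SchurWeyl.rho]
      · simpa [SchurWeyl.rho] using ha0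
  obtain ⟨b, hb, hgcd⟩ := Finset.extract_gcd a (Finset.univ_nonempty (α := Fin (s + 1)))
  set d := Finset.univ.gcd a with hd
  have hab : a = fun j => d * b j := funext fun j => hb j (Finset.mem_univ j)
  have ha1 : 0 < a 0 := SparsePolynomial.exponent_pos h_anti ha0 (by simp [Fin.ext_iff]; lia)
  have hd0 : d ≠ 0 := by
    intro h
    rw [hab] at ha1
    simp [h] at ha1
  have hbanti : StrictAnti b := by
    intro i j hij
    have := h_anti hij
    rw [hab] at this
    exact Nat.lt_of_mul_lt_mul_left this
  have hb0 : b (Fin.last s) = 0 := by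
    rw [hab] at ha0
    exact (Nat.mul_eq_zero.mp ha0).resolve_left hd0
  obtain ⟨P, hP⟩ := SparsePolynomial.S_smul_rho_dvd_S d b
  rw [mul_comm] at hP
  refine ⟨P, ?_, SparsePolynomial.irreducible_quotient hbanti hb0 hs hgcd hd0 ?_ hP.symm⟩
  · have hV : SchurWeyl.S (d • SchurWeyl.rho (s + 1)) ≠ 0 := by
      intro h
      rw [h, mul_zero] at hP
      refine SparsePolynomial.S_ne_zero (fun i j hij => ?_) hP
      exact hbanti.injective (Nat.eq_of_mul_eq_mul_left (Nat.pos_of_ne_zero hd0) hij)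
    have hS : SchurWeyl.S a = P * SchurWeyl.S (d • SchurWeyl.rho (s + 1)) := by
      rw [← hP, ← hab]
    rw [SchurWeyl.C, eq_div_iff, hS, map_mul]
    · rfl
    · exact (map_ne_zero_iff _ (IsFractionRing.injective _ _)).mpr hV
  · intro h
    apply h_rho
    refine ⟨d, ?_⟩
    rw [hab, h]
    rfl
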